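/- A network $(G,c)$ is a non-empty vertex set $G$ with a conductance function $c:G\times G\to[0,\infty)$, $c_{xy}=c_{yx}$, $c_{xx}=0$, such that the graph with $x\sim y$ iff $c_{xy}>0$ is connected and locally finite. Let $$\mathcal E_c(u,v)=\tfrac12\sum_{x,y\in G}c_{xy}\,(\overline{u(x)}-\overline{u(y)})(v(x)-v(y)),$$ let $\mathcal H_{\mathcal E_c}$ be the Hilbert space of functions $u:G\to\mathbb C$ with $\mathcal E_c(u,u)<\infty$ modulo constants, with inner product $\mathcal E_c$, fix $o\in G$, and let $v_x^{(c)}\in\mathcal H_{\mathcal E_c}$ ($x\in G$) be the element with $\langle v_x^{(c)},u\rangle_{\mathcal E_c}=u(x)-u(o)$ for all $u\in\mathcal H_{\mathcal E_c}$. The Laplacian $(\Delta_c u)(x)=\sum_{y\sim x}c_{xy}(u(x)-u(y))$ with domain $\operatorname{span}\{v_x^{(c)}\}_{x\in G}$ is a densely defined nonnegative operator on $\mathcal H_{\mathcal E_c}$; let $L_c$ be its Friedrichs extension (the restriction of the adjoint to the domain of the closure of the quadratic form), and let $P_c$ be the projection-valued measure on the Borel sets of $[0,\infty)$ with $L_c=\int_0^\infty\lambda\,dP_c(\lambda)$.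 For $u\in\mathcal H_{\mathcal E_c}$ put $\mu_u^{(c)}(B)=\|P_c(B)u\|_{\mathcal E_c}^2$ and $m_k^{(c)}(u)=\int_0^\infty\lambda^k\,d\mu_u^{(c)}(\lambda)\in[0,\infty]$. Theorem (Monotonicity of spectral measures). Let $(G,b)$ and $(G,c)$ be networks on the same vertex set with $b_{xy}\le c_{xy}$ for all $x,y\in G$, and let $I:\mathcal H_{\mathcal E_c}\to\mathcal H_{\mathcal E_b}$, $Iu=u$, be the contractive inclusion, with adjoint $I^*:\mathcal H_{\mathcal E_b}\to\mathcal H_{\mathcal E_c}$. Then the spectral resolutions $P_b$ and $P_c$ exist, and for every $u\in\mathcal H_{\mathcal E_b}$ $$m_1^{(b)}(u)=m_1^{(c)}(I^*u)\qquad\text{and}\qquad m_2^{(b)}(u)\le m_2^{(c)}(I^*u)$$ as elements of $[0,\infty]$. -/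

import Mathlib

open scoped ComplexConjugate NNReal ENNReal InnerProductSpace Topology
open Filter MeasureTheory

noncomputable section

/-- A resistance network on the vertex set `G`: a symmetric conductance function with values in
`[0, ∞)` and without loops, such that the graph in which `x` and `y` are neighbours iff
`0 < cond x y` is locally finite and connected. -/
structure Network (G : Type*) where
  cond : G → G → ℝ
  symm : ∀ x y, cond x y = cond y x
  nonneg : ∀ x y, 0 ≤ cond x y
  loopless : ∀ x, cond x x = 0
  locallyFinite : ∀ x, {y | 0 < cond x y}.Finite
  connected : ∀ x y, Relation.ReflTransGen (fun z w => 0 < cond z w) x y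

namespace Network

variable {G : Type*} (N : Network G)

/-- The (finite) set of neighbours of a vertex. -/
def nbrs (x : G) : Finset G := (N.locallyFinite x).toFinset

theorem mem_nbrs {x y : G} : y ∈ N.nbrs x ↔ 0 < N.cond x y := by
  simp [nbrs]

theorem cond_eq_zero {x y : G} (h : y ∉ N.nbrs x) : N.cond x y = 0 := by
  rw [mem_nbrs, not_lt] at h
  exact le_antisymm h (N.nonneg x y)

/-- The pointwise Laplacian `(Δ u)(x) = ∑_{y ∼ x} c_{xy} (u(x) - u(y))`. -/
def lap : (G → ℂ) →ₗ[ℂ] (G → ℂ) where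
  toFun u x := ∑ y ∈ N.nbrs x, (N.cond x y : ℂ) * (u x - u y)
  map_add' u v := by
    funext x
    simp only [Pi.add_apply, ← Finset.sum_add_distrib]
    exact Finset.sum_congr rfl fun y _ => by ring
  map_smul' a u := by
    funext x
    simp only [Pi.smul_apply, smul_eq_mul, RingHom.id_apply, Finset.mul_sum]
    exact Finset.sum_congr rfl fun y _ => by ring

/-- The energy form `E(u, v) = 1/2 ∑_{x, y} c_{xy} conj(u(x) - u(y)) (v(x) - v(y))`. -/
def energy (u v : G → ℂ) : ℂ :=
  (1 / 2 : ℂ) * ∑' p : G × G,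
    (N.cond p.1 p.2 : ℂ) * (conj (u p.1) - conj (u p.2)) * (v p.1 - v p.2)

/-- Finite energy: the series of nonnegative terms `c_{xy} |u(x) - u(y)|^2` converges. -/
def FiniteEnergy (u : G → ℂ) : Prop :=
  Summable fun p : G × G => N.cond p.1 p.2 * ‖u p.1 - u p.2‖ ^ 2

/-- Auxiliary weighted gradient `(x, y) ↦ √(c_{xy} / 2) (u(x) - u(y))`. -/
def gradFun (u : G → ℂ) (p : G × G) : ℂ :=
  (Real.sqrt (N.cond p.1 p.2 / 2) : ℂ) * (u p.1 - u p.2)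

theorem norm_gradFun_sq (u : G → ℂ) (p : G × G) :
    ‖N.gradFun u p‖ ^ 2 = 1 / 2 * (N.cond p.1 p.2 * ‖u p.1 - u p.2‖ ^ 2) := by
  rw [gradFun, norm_mul, mul_pow, Complex.norm_real, Real.norm_eq_abs, sq_abs,
    Real.sq_sqrt (by have := N.nonneg p.1 p.2; positivity)]
  ring

theorem memlp_gradFun_iff (u : G → ℂ) :
    Memℓp (N.gradFun u) 2 ↔ N.FiniteEnergy u := by
  rw [memℓp_gen_iff (by norm_num), FiniteEnergy]
  simp only [ENNReal.toReal_ofNat, Real.rpow_ofNat, norm_gradFun_sq]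
  exact summable_mul_left_iff (by norm_num)

theorem gradFun_add (u v : G → ℂ) : N.gradFun (u + v) = N.gradFun u + N.gradFun v := by
  funext p; simp only [gradFun, Pi.add_apply]; ring

theorem gradFun_smul (a : ℂ) (u : G → ℂ) : N.gradFun (a • u) = a • N.gradFun u := by
  funext p; simp only [gradFun, Pi.smul_apply, smul_eq_mul]; ring

/-- The domain of the energy form. -/
def energyDomain : Submodule ℂ (G → ℂ) where
  carrier := {u | N.FiniteEnergy u}
  zero_mem' := by simp [FiniteEnergy, summable_zero]
  add_mem' {u v} hu hv := by
    have hu' := (N.memlp_gradFun_iff u).2 hu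
    have hv' := (N.memlp_gradFun_iff v).2 hv
    refine (N.memlp_gradFun_iff _).1 ?_
    rw [gradFun_add]; exact hu'.add hv'
  smul_mem' a u hu := by
    have hu' := (N.memlp_gradFun_iff u).2 hu
    refine (N.memlp_gradFun_iff _).1 ?_
    rw [gradFun_smul]; exact hu'.const_smul a

/-- The constant functions, as a subspace of the domain of the energy form. -/
def constants : Submodule ℂ N.energyDomain :=
  (Submodule.span ℂ {(1 : G → ℂ)}).comap N.energyDomain.subtype

/-- The energy space: functions of finite energy modulo constants. -/
def EnergySpace : Type _ := N.energyDomain ⧸ N.constants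

instance : AddCommGroup N.EnergySpace :=
  inferInstanceAs (AddCommGroup (N.energyDomain ⧸ N.constants))

instance : Module ℂ N.EnergySpace :=
  inferInstanceAs (Module ℂ (N.energyDomain ⧸ N.constants))

/-- The class in the energy space of a function of finite energy. -/
def toEnergy : N.energyDomain →ₗ[ℂ] N.EnergySpace := N.constants.mkQ

theorem mk_surjective : Function.Surjective N.toEnergy := N.constants.mkQ_surjective

theorem mem_constants (u : N.energyDomain) :
    u ∈ N.constants ↔ ∃ k : ℂ, ∀ x, (u : G → ℂ) x = k := by
  simp only [constants, Submodule.mem_comap, Submodule.mem_span_singleton, Submodule.subtype_apply]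
  refine exists_congr fun k => ⟨fun h x => by simp [← h], fun h => ?_⟩
  funext x; simp [h x]

/-- A linear map on the functions of finite energy that kills constants, on the energy space. -/
def lift {V : Type*} [AddCommGroup V] [Module ℂ V] (f : N.energyDomain →ₗ[ℂ] V)
    (h : N.constants ≤ LinearMap.ker f) : N.EnergySpace →ₗ[ℂ] V := N.constants.liftQ f h

theorem lift_mk {V : Type*} [AddCommGroup V] [Module ℂ V] (f : N.energyDomain →ₗ[ℂ] V)
    (h : N.constants ≤ LinearMap.ker f) (u : N.energyDomain) : N.lift f h (N.toEnergy u) = f u := rfl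

/-- Auxiliary weighted gradient as a linear map from the functions of finite energy to `ℓ²`. -/
def gradDom : N.energyDomain →ₗ[ℂ] lp (fun _ : G × G => ℂ) 2 where
  toFun u := ⟨N.gradFun u, (N.memlp_gradFun_iff _).2 u.2⟩
  map_add' u v := Subtype.ext (N.gradFun_add u v)
  map_smul' a u := Subtype.ext (N.gradFun_smul a u)

theorem gradDom_const (u : N.energyDomain) (hu : u ∈ N.constants) : N.gradDom u = 0 := by
  obtain ⟨k, hk⟩ := (N.mem_constants u).1 hu
  ext p
  simp [gradDom, gradFun, hk]

/-- Auxiliary weighted gradient on the energy space. -/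
def grad : N.EnergySpace →ₗ[ℂ] lp (fun _ : G × G => ℂ) 2 :=
  N.lift N.gradDom fun u hu => N.gradDom_const u hu

theorem grad_mk_apply (u : N.energyDomain) (p : G × G) :
    N.grad (N.toEnergy u) p = N.gradFun u p := rfl

theorem inner_grad (u v : N.energyDomain) :
    ⟪N.grad (N.toEnergy u), N.grad (N.toEnergy v)⟫_ℂ = N.energy u v := by
  rw [lp.inner_eq_tsum, energy, ← tsum_mul_left]
  refine tsum_congr fun p => ?_
  rw [grad_mk_apply, grad_mk_apply, gradFun, gradFun]
  simp only [RCLike.inner_apply, map_mul, map_sub, Complex.conj_ofReal]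
  have h : (Real.sqrt (N.cond p.1 p.2 / 2) : ℂ) * (Real.sqrt (N.cond p.1 p.2 / 2) : ℂ)
      = (N.cond p.1 p.2 : ℂ) / 2 := by
    rw [← Complex.ofReal_mul, Real.mul_self_sqrt (by have := N.nonneg p.1 p.2; positivity)]
    push_cast; ring
  linear_combination (((starRingEnd ℂ) ((u : G → ℂ) p.1) - (starRingEnd ℂ) ((u : G → ℂ) p.2)) *
    ((v : G → ℂ) p.1 - (v : G → ℂ) p.2)) * h

/-- A representative of an element of the energy space. -/
def rep (u : N.EnergySpace) : N.energyDomain := (N.mk_surjective u).choose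

theorem mk_rep (u : N.EnergySpace) : N.toEnergy (N.rep u) = u := (N.mk_surjective u).choose_spec

/-- A bound for differences of values in terms of the weighted gradient. -/
theorem exists_bound (x y : G) :
    ∃ K : ℝ, ∀ u : N.energyDomain, ‖(u : G → ℂ) x - (u : G → ℂ) y‖ ≤ K * ‖N.grad (N.toEnergy u)‖ := by
  induction N.connected x y with
  | refl => exact ⟨0, fun u => by simp⟩
  | @tail y z _ hyz ih =>
    obtain ⟨K, hK⟩ := ih
    have hs : 0 < Real.sqrt (N.cond y z / 2) := Real.sqrt_pos.2 (by positivity)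
    refine ⟨K + (Real.sqrt (N.cond y z / 2))⁻¹, fun u => ?_⟩
    have h1 : Real.sqrt (N.cond y z / 2) * ‖(u : G → ℂ) y - (u : G → ℂ) z‖
        ≤ ‖N.grad (N.toEnergy u)‖ := by
      have h := lp.norm_apply_le_norm (by norm_num) (N.grad (N.toEnergy u)) (y, z)
      rw [grad_mk_apply, gradFun, norm_mul, Complex.norm_real, Real.norm_eq_abs,
        abs_of_pos hs] at h
      exact h
    have h2 : ‖(u : G → ℂ) y - (u : G → ℂ) z‖
        ≤ (Real.sqrt (N.cond y z / 2))⁻¹ * ‖N.grad (N.toEnergy u)‖ := by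
      rw [inv_mul_eq_div, le_div_iff₀ hs, mul_comm]; exact h1
    calc ‖(u : G → ℂ) x - (u : G → ℂ) z‖
        ≤ ‖(u : G → ℂ) x - (u : G → ℂ) y‖ + ‖(u : G → ℂ) y - (u : G → ℂ) z‖ :=
          norm_sub_le_norm_sub_add_norm_sub _ _ _
      _ ≤ _ := by rw [add_mul]; exact add_le_add (hK u) h2

theorem grad_injective (u : N.EnergySpace) (hu : N.grad u = 0) : u = 0 := by
  obtain ⟨u, rfl⟩ := N.mk_surjective u
  refine (Submodule.Quotient.mk_eq_zero N.constants).2 ((N.mem_constants u).2 ?_)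
  rcases isEmpty_or_nonempty G with hG | ⟨⟨o⟩⟩
  · exact ⟨0, fun x => isEmptyElim x⟩
  · refine ⟨(u : G → ℂ) o, fun x => ?_⟩
    obtain ⟨K, hK⟩ := N.exists_bound x o
    have h := hK u
    rw [hu, norm_zero, mul_zero] at h
    exact sub_eq_zero.1 (norm_le_zero_iff.1 h)

/-- The energy form on classes, with the properties of an inner product. -/
abbrev energyCore : InnerProductSpace.Core ℂ N.EnergySpace where
  inner u v := N.energy (N.rep u) (N.rep v)
  conj_inner_symm u v := by
    simp only [← inner_grad, mk_rep]; exact inner_conj_symm _ _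
  re_inner_nonneg u := by
    simp only [← inner_grad, mk_rep]; exact inner_self_nonneg
  add_left u v w := by
    simp only [← inner_grad, mk_rep, map_add]; exact inner_add_left _ _ _
  smul_left u v a := by
    simp only [← inner_grad, mk_rep, map_smul]; exact inner_smul_left _ _ _
  definite u h := by
    simp only [← inner_grad, mk_rep] at h
    exact N.grad_injective u (inner_self_eq_zero.1 h)

instance : NormedAddCommGroup N.EnergySpace := N.energyCore.toNormedAddCommGroup

instance : InnerProductSpace ℂ N.EnergySpace := InnerProductSpace.ofCore N.energyCore.toCore

theorem inner_eq_inner_grad (u v : N.EnergySpace) : ⟪u, v⟫_ℂ = ⟪N.grad u, N.grad v⟫_ℂ := by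
  change N.energy (N.rep u) (N.rep v) = _
  rw [← inner_grad, mk_rep, mk_rep]

/-- The inner product of the energy space is the energy form. -/
theorem inner_mk (u v : N.energyDomain) : ⟪N.toEnergy u, N.toEnergy v⟫_ℂ = N.energy u v := by
  rw [inner_eq_inner_grad, inner_grad]

theorem norm_grad (u : N.EnergySpace) : ‖N.grad u‖ = ‖u‖ := by
  rw [@norm_eq_sqrt_re_inner ℂ, @norm_eq_sqrt_re_inner ℂ, inner_eq_inner_grad]

/-- The weighted gradient as an isometric embedding. -/
def gradIso : N.EnergySpace →ₗᵢ[ℂ] lp (fun _ : G × G => ℂ) 2 := ⟨N.grad, N.norm_grad⟩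

instance : CompleteSpace N.EnergySpace := by
  have hiso : Isometry N.gradIso := N.gradIso.isometry
  have hclosed : IsClosed (Set.range N.gradIso) := by
    refine IsSeqClosed.isClosed fun f g hf hg => ?_
    choose w hw using hf
    have hpt : ∀ p, Tendsto (fun n => f n p) atTop (𝓝 (g p)) := fun p => by
      have h := (lp.lipschitzWith_one_eval (E := fun _ : G × G => ℂ) 2 p).continuous.tendsto g
      exact h.comp hg
    have hwc : CauchySeq w := by
      have h := hg.cauchySeq
      have : f = fun n => N.gradIso (w n) := funext fun n => (hw n).symm
      rw [this] at h
      rw [Metric.cauchySeq_iff'] at h ⊢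
      simpa only [hiso.dist_eq] using h
    have hex : ∀ x y : G, ∃ l : ℂ,
        Tendsto (fun n => (N.rep (w n) : G → ℂ) x - (N.rep (w n) : G → ℂ) y) atTop (𝓝 l) := by
      intro x y
      obtain ⟨K, hK⟩ := N.exists_bound x y
      refine cauchySeq_tendsto_of_complete ?_
      rw [Metric.cauchySeq_iff'] at hwc ⊢
      intro ε hε
      have hK' : 0 < |K| + 1 := by positivity
      obtain ⟨n₀, hn₀⟩ := hwc (ε / (|K| + 1)) (by positivity)
      refine ⟨n₀, fun n hn => ?_⟩
      have h1 := hK (N.rep (w n) - N.rep (w n₀))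
      rw [map_sub, mk_rep, mk_rep, norm_grad] at h1
      have h2 := hn₀ n hn
      rw [lt_div_iff₀ hK'] at h2
      rw [← dist_eq_norm (w n) (w n₀)] at h1
      have h3 : K * dist (w n) (w n₀) ≤ dist (w n) (w n₀) * (|K| + 1) := by
        have := le_abs_self K
        have h0 : 0 ≤ dist (w n) (w n₀) := dist_nonneg
        nlinarith
      rw [dist_eq_norm]
      refine lt_of_le_of_lt (le_trans (le_of_eq ?_) (h1.trans h3)) h2
      congr 1
      simp only [Submodule.coe_sub, Pi.sub_apply]
      ring
    rcases isEmpty_or_nonempty G with hG | ⟨⟨o⟩⟩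
    · exact ⟨0, by ext p; exact isEmptyElim p.1⟩
    choose l hl using fun x => hex x o
    have hlg : N.gradFun l = g := by
      funext p
      refine tendsto_nhds_unique ?_ (hpt p)
      have h1 := ((hl p.1).sub (hl p.2)).const_mul (Real.sqrt (N.cond p.1 p.2 / 2) : ℂ)
      refine h1.congr fun n => ?_
      rw [← hw n]
      conv_rhs => rw [← N.mk_rep (w n)]
      change _ = N.gradFun _ p
      rw [gradFun]; ring
    have hfin : N.FiniteEnergy l := by
      rw [← memlp_gradFun_iff, hlg]; exact lp.memℓp g
    refine ⟨N.toEnergy ⟨l, hfin⟩, ?_⟩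
    ext p
    exact congrFun hlg p
  exact (completeSpace_iff_isComplete_range hiso.isUniformInducing).2 hclosed.isComplete

/-- The bounded functional `u ↦ u(x) - u(y)` on the energy space. -/
def evalDiff (x y : G) : N.EnergySpace →L[ℂ] ℂ :=
  LinearMap.mkContinuousOfExistsBound
    (N.lift (((LinearMap.proj x : (G → ℂ) →ₗ[ℂ] ℂ) - LinearMap.proj y).comp
        N.energyDomain.subtype) (by
      intro u hu
      obtain ⟨k, hk⟩ := (N.mem_constants u).1 hu
      simp [hk]))
    (by
      obtain ⟨K, hK⟩ := N.exists_bound x y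
      refine ⟨K, fun u => ?_⟩
      obtain ⟨u, rfl⟩ := N.mk_surjective u
      rw [lift_mk, ← norm_grad]
      exact hK u)

theorem evalDiff_mk (x y : G) (u : N.energyDomain) :
    N.evalDiff x y (N.toEnergy u) = (u : G → ℂ) x - (u : G → ℂ) y := rfl

/-- The energy kernel: `v_x` is the element with `⟪v_x, u⟫ = u(x) - u(o)` for all `u`. -/
def kernel (o x : G) : N.EnergySpace :=
  (InnerProductSpace.toDual ℂ N.EnergySpace).symm (N.evalDiff x o)

theorem inner_kernel (o x : G) (u : N.EnergySpace) : ⟪N.kernel o x, u⟫_ℂ = N.evalDiff x o u := by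
  simp [kernel]

/-- The pointwise Laplacian of an element of the energy space (constants have Laplacian `0`). -/
def lapE : N.EnergySpace →ₗ[ℂ] (G → ℂ) :=
  N.lift (N.lap.comp N.energyDomain.subtype) (by
    intro u hu
    obtain ⟨k, hk⟩ := (N.mem_constants u).1 hu
    rw [LinearMap.mem_ker]
    funext x
    simp [lap, hk])

theorem lapE_mk (u : N.energyDomain) : N.lapE (N.toEnergy u) = N.lap u := rfl

open Classical in
theorem support_single (x : G) (p : G × G)
    (hp : p ∉ ({x} : Finset G) ×ˢ N.nbrs x ∪ N.nbrs x ×ˢ ({x} : Finset G)) :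
    N.cond p.1 p.2 = 0 ∨
      (Pi.single x 1 : G → ℂ) p.1 = 0 ∧ (Pi.single x 1 : G → ℂ) p.2 = 0 := by
  simp only [Finset.mem_union, Finset.mem_product, Finset.mem_singleton, not_or, not_and] at hp
  by_cases h1 : p.1 = x
  · left
    have h := N.cond_eq_zero (hp.1 h1)
    rwa [h1]
  · by_cases h2 : p.2 = x
    · left
      have h := N.cond_eq_zero (fun h => hp.2 h h2)
      rw [N.symm, h2]; exact h
    · right
      exact ⟨Pi.single_eq_of_ne h1 _, Pi.single_eq_of_ne h2 _⟩

open Classical in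
/-- The Dirac mass at `x`, a function of finite energy. -/
def dirac (x : G) : N.energyDomain :=
  ⟨Pi.single x 1, by
    refine summable_of_ne_finset_zero
      (s := ({x} : Finset G) ×ˢ N.nbrs x ∪ N.nbrs x ×ˢ ({x} : Finset G)) fun p hp => ?_
    rcases N.support_single x p hp with h | ⟨h1, h2⟩
    · simp [h]
    · simp [h1, h2]⟩

open Classical in
theorem dirac_apply (x y : G) : (N.dirac x : G → ℂ) y = if y = x then 1 else 0 := by
  simp [dirac, Pi.single_apply]

/-- `⟪δ_x, u⟫ = (Δ u)(x)`. -/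
theorem inner_dirac (x : G) (u : N.EnergySpace) : ⟪N.toEnergy (N.dirac x), u⟫_ℂ = N.lapE u x := by
  classical
  obtain ⟨u, rfl⟩ := N.mk_surjective u
  have hx : x ∉ N.nbrs x := by rw [mem_nbrs, N.loopless]; exact lt_irrefl _
  have hdisj : Disjoint (({x} : Finset G) ×ˢ N.nbrs x) (N.nbrs x ×ˢ ({x} : Finset G)) := by
    rw [Finset.disjoint_left]
    intro p h1 h2
    simp only [Finset.mem_product, Finset.mem_singleton] at h1 h2
    exact hx (h1.1 ▸ h2.1)
  rw [inner_mk, lapE_mk, energy,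
    tsum_eq_sum (s := ({x} : Finset G) ×ˢ N.nbrs x ∪ N.nbrs x ×ˢ ({x} : Finset G)),
    Finset.sum_union hdisj, Finset.sum_product, Finset.sum_product_right]
  · simp only [Finset.sum_singleton]
    rw [← Finset.sum_add_distrib, Finset.mul_sum]
    change _ = ∑ y ∈ N.nbrs x, _
    refine Finset.sum_congr rfl fun y hy => ?_
    have hyx : y ≠ x := fun h => hx (h ▸ hy)
    rw [N.symm y x]
    simp only [dirac_apply, hyx, if_true, if_false, map_one, map_zero]
    ring
  · intro p hp
    rcases N.support_single x p hp with h | ⟨h1, h2⟩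
    · simp [h]
    · simp [dirac, h1, h2]

/-- `Δ v_x = δ_x - δ_o`. -/
theorem lapE_kernel (o x : G) :
    N.lapE (N.kernel o x) = ((N.dirac x - N.dirac o : N.energyDomain) : G → ℂ) := by
  classical
  funext y
  rw [← inner_dirac, ← inner_conj_symm, inner_kernel, evalDiff_mk]
  simp only [Submodule.coe_sub, Pi.sub_apply, dirac_apply, map_sub, apply_ite conj, map_one,
    map_zero, eq_comm]

/-- The span of the energy kernel. -/
def kernelSpan (o : G) : Submodule ℂ N.EnergySpace :=
  Submodule.span ℂ (Set.range (N.kernel o))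

theorem lapE_mem (o : G) (u : N.kernelSpan o) : N.lapE u ∈ N.energyDomain := by
  obtain ⟨u, hu⟩ := u
  change N.lapE u ∈ _
  induction hu using Submodule.span_induction with
  | mem u hu =>
    obtain ⟨x, rfl⟩ := hu
    rw [lapE_kernel]; exact Subtype.prop _
  | zero => rw [map_zero]; exact zero_mem _
  | add u v _ _ hu hv => rw [map_add]; exact add_mem hu hv
  | smul a u _ hu => rw [map_smul]; exact Submodule.smul_mem _ _ hu

/-- The Laplacian as an unbounded operator on the energy space, with domain the span of the
energy kernel. -/
def laplacian (o : G) : N.EnergySpace →ₗ.[ℂ] N.EnergySpace where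
  domain := N.kernelSpan o
  toFun := N.toEnergy.comp ((N.lapE.domRestrict (N.kernelSpan o)).codRestrict N.energyDomain
    (N.lapE_mem o))

theorem laplacian_apply (o : G) (u : (N.laplacian o).domain) :
    N.laplacian o u = N.toEnergy ⟨N.lapE u, N.lapE_mem o u⟩ := rfl

theorem inner_kernelSpan (o : G) (u : N.EnergySpace) (hu : u ∈ N.kernelSpan o) :
    (Function.support (N.lapE u)).Finite ∧ ∀ f : N.energyDomain,
      ⟪u, N.toEnergy f⟫_ℂ = ∑ᶠ x, conj (N.lapE u x) * (f : G → ℂ) x := by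
  classical
  induction hu using Submodule.span_induction with
  | mem u hu =>
    obtain ⟨x, rfl⟩ := hu
    have hs : Function.support (N.lapE (N.kernel o x)) ⊆ (({x, o} : Finset G) : Set G) := by
      intro y hy
      by_contra h
      simp only [Finset.coe_insert, Finset.coe_singleton, Set.mem_insert_iff,
        Set.mem_singleton_iff, not_or] at h
      exact hy (by simp [lapE_kernel, dirac_apply, h.1, h.2])
    refine ⟨(Finset.finite_toSet _).subset hs, fun f => ?_⟩
    have hs' : Function.support (fun y => conj (N.lapE (N.kernel o x) y) * (f : G → ℂ) y)
        ⊆ (({x, o} : Finset G) : Set G) := fun y hy => hs fun h => hy (by simp [h])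
    rw [finsum_eq_sum_of_support_subset _ hs', inner_kernel, evalDiff_mk]
    by_cases hxo : x = o
    · subst hxo
      simp [lapE_kernel]
    · have hox : o ≠ x := fun h => hxo h.symm
      rw [Finset.sum_pair hxo]
      simp [lapE_kernel, dirac_apply, hxo, hox, sub_eq_add_neg]
  | zero => simp
  | add u v _ _ hu hv =>
    refine ⟨(hu.1.union hv.1).subset ?_, fun f => ?_⟩
    · rw [map_add]; exact Function.support_add _ _
    · rw [inner_add_left, hu.2, hv.2, ← finsum_add_distrib]
      · refine finsum_congr fun x => ?_
        simp only [map_add, Pi.add_apply]; ring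
      · exact hu.1.subset fun y hy h => hy (by simp [h])
      · exact hv.1.subset fun y hy h => hy (by simp [h])
  | smul a u _ hu =>
    refine ⟨hu.1.subset ?_, fun f => ?_⟩
    · rw [map_smul]; exact Function.support_const_smul_subset _ _
    · rw [inner_smul_left, hu.2, mul_finsum]
      · refine finsum_congr fun x => ?_
        simp only [map_smul, Pi.smul_apply, smul_eq_mul, map_mul]; ring

/-- The Laplacian is a nonnegative operator. -/
theorem laplacian_nonneg (o : G) (u : (N.laplacian o).domain) :
    0 ≤ (⟪(u : N.EnergySpace), N.laplacian o u⟫_ℂ).re := by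
  obtain ⟨hfin, h⟩ := N.inner_kernelSpan o u u.2
  rw [laplacian_apply, h, finsum_eq_sum_of_support_subset (s := hfin.toFinset), Complex.re_sum]
  · refine Finset.sum_nonneg fun x _ => ?_
    rw [← Complex.normSq_eq_conj_mul_self, Complex.ofReal_re]
    exact Complex.normSq_nonneg _
  · intro x hx
    simp only [Set.Finite.coe_toFinset]
    exact fun h => hx (by simp [h])

end Network

section Friedrichs

variable {H : Type*} [NormedAddCommGroup H] [InnerProductSpace ℂ H]

/-- The quadratic form `⟪u, A u⟫` of an unbounded operator. -/
def LinearPMap.quadForm (A : H →ₗ.[ℂ] H) (u : A.domain) : ℝ := (⟪(u : H), A u⟫_ℂ).re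

theorem LinearPMap.quadForm_add_le (A : H →ₗ.[ℂ] H) (hA : ∀ u : A.domain, 0 ≤ A.quadForm u)
    (u v : A.domain) : A.quadForm (u + v) ≤ 2 * A.quadForm u + 2 * A.quadForm v := by
  have h := hA (u - v)
  simp only [quadForm, LinearPMap.map_add, LinearPMap.map_sub, Submodule.coe_add,
    Submodule.coe_sub, inner_add_left, inner_add_right, inner_sub_left, inner_sub_right,
    Complex.add_re, Complex.sub_re] at h ⊢
  linarith

theorem LinearPMap.quadForm_smul (A : H →ₗ.[ℂ] H) (a : ℂ) (u : A.domain) :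
    A.quadForm (a • u) = ‖a‖ ^ 2 * A.quadForm u := by
  rw [quadForm, LinearPMap.map_smul, Submodule.coe_smul, inner_smul_left, inner_smul_right,
    ← mul_assoc, ← Complex.normSq_eq_conj_mul_self, Complex.normSq_eq_norm_sq,
    Complex.re_ofReal_mul, quadForm]

/-- The domain of the closure of the quadratic form of a nonnegative operator `A`: the limits of
sequences in the domain of `A` which converge in `H` and are Cauchy for the quadratic form. -/
def formDomain (A : H →ₗ.[ℂ] H) (hA : ∀ u : A.domain, 0 ≤ A.quadForm u) : Submodule ℂ H where
  carrier := {u | ∃ s : ℕ → A.domain, Tendsto (fun n => (s n : H)) atTop (𝓝 u) ∧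
    Tendsto (fun p : ℕ × ℕ => A.quadForm (s p.1 - s p.2)) atTop (𝓝 0)}
  zero_mem' := ⟨0, by simp, by simp [LinearPMap.quadForm]⟩
  add_mem' := by
    rintro u v ⟨s, hs, hs'⟩ ⟨t, ht, ht'⟩
    refine ⟨s + t, by simpa using hs.add ht, ?_⟩
    refine squeeze_zero (fun p => hA _) (fun p => ?_)
      (by simpa using (hs'.const_mul 2).add (ht'.const_mul 2))
    have h : (s + t) p.1 - (s + t) p.2 = (s p.1 - s p.2) + (t p.1 - t p.2) := by
      simp only [Pi.add_apply]; abel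
    rw [h]
    exact A.quadForm_add_le hA _ _
  smul_mem' := by
    rintro a u ⟨s, hs, hs'⟩
    refine ⟨a • s, by simpa using hs.const_smul a, ?_⟩
    have h : (fun p : ℕ × ℕ => A.quadForm ((a • s) p.1 - (a • s) p.2))
        = fun p => ‖a‖ ^ 2 * A.quadForm (s p.1 - s p.2) := by
      funext p
      rw [← A.quadForm_smul, smul_sub]; rfl
    rw [h]
    simpa using hs'.const_mul (‖a‖ ^ 2)

/-- The Friedrichs extension of a densely defined nonnegative operator: the restriction of its
adjoint to the domain of the closure of its quadratic form. -/
def friedrichsExtension [CompleteSpace H] (A : H →ₗ.[ℂ] H)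
    (hA : ∀ u : A.domain, 0 ≤ A.quadForm u) : H →ₗ.[ℂ] H :=
  A.adjoint.domRestrict (formDomain A hA)

end Friedrichs

section Spectral

variable {H : Type*} [NormedAddCommGroup H] [InnerProductSpace ℂ H] [CompleteSpace H]

/-- A projection-valued measure on the Borel sets of `[0, ∞)`. (The values on sets that are not
measurable play no role.) -/
structure ProjectionValuedMeasure (H : Type*) [NormedAddCommGroup H] [InnerProductSpace ℂ H]
    [CompleteSpace H] where
  proj : Set ℝ≥0 → (H →L[ℂ] H)
  isStarProjection : ∀ B, MeasurableSet B → IsStarProjection (proj B)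
  proj_univ : proj Set.univ = 1
  proj_inter : ∀ A B, MeasurableSet A → MeasurableSet B → proj (A ∩ B) = proj A * proj B
  hasSum_iUnion : ∀ B : ℕ → Set ℝ≥0, (∀ n, MeasurableSet (B n)) →
    Pairwise (Function.onFun Disjoint B) → ∀ u : H,
      HasSum (fun n => proj (B n) u) (proj (⋃ n, B n) u)

namespace ProjectionValuedMeasure

variable (P : ProjectionValuedMeasure H)

theorem norm_sq_eq (B : Set ℝ≥0) (hB : MeasurableSet B) (u : H) :
    ‖P.proj B u‖ ^ 2 = (⟪u, P.proj B u⟫_ℂ).re := by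
  have h := P.isStarProjection B hB
  have h1 : P.proj B (P.proj B u) = P.proj B u := by
    conv_rhs => rw [← h.isIdempotentElem.eq]
    rfl
  have h2 : ContinuousLinearMap.adjoint (P.proj B) = P.proj B := h.isSelfAdjoint
  calc ‖P.proj B u‖ ^ 2 = (⟪P.proj B u, P.proj B u⟫_ℂ).re := by
        rw [@norm_sq_eq_re_inner ℂ]; rfl
    _ = _ := by
        rw [← ContinuousLinearMap.adjoint_inner_right, h2, h1]

/-- The measure `B ↦ ‖P(B) u‖²` on `[0, ∞)`. -/
def measure (u : H) : Measure ℝ≥0 :=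
  Measure.ofMeasurable (fun B _ => ENNReal.ofReal (‖P.proj B u‖ ^ 2))
    (by
      have h := P.hasSum_iUnion (fun _ => ∅) (fun _ => MeasurableSet.empty)
        (fun _ _ _ => by simp [Function.onFun]) u
      have h0 : P.proj ∅ u = 0 := (summable_const_iff _).1 h.summable
      simp [h0])
    (by
      intro B hB hd
      have h := P.hasSum_iUnion B hB hd u
      have h' : HasSum (fun n => ‖P.proj (B n) u‖ ^ 2) (‖P.proj (⋃ n, B n) u‖ ^ 2) := by
        simp only [P.norm_sq_eq _ (hB _), P.norm_sq_eq _ (MeasurableSet.iUnion hB)]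
        exact Complex.hasSum_re (h.mapL (innerSL ℂ u))
      rw [← ENNReal.ofReal_tsum_of_nonneg (fun n => sq_nonneg _) h'.summable, h'.tsum_eq])

theorem measure_apply (u : H) (B : Set ℝ≥0) (hB : MeasurableSet B) :
    P.measure u B = ENNReal.ofReal (‖P.proj B u‖ ^ 2) :=
  Measure.ofMeasurable_apply B hB

/-- `P` is the spectral resolution of `L`, that is, `L = ∫ λ dP(λ)`: the domain of `L` consists of
the `u` with `∫ λ² d‖P(λ) u‖² < ∞`, and `⟪u, L u⟫ = ∫ λ d‖P(λ) u‖²` for these `u`. -/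
structure IsSpectralResolution (L : H →ₗ.[ℂ] H) : Prop where
  mem_domain_iff : ∀ u : H, u ∈ L.domain ↔ ∫⁻ t, (t : ℝ≥0∞) ^ 2 ∂(P.measure u) < ∞
  inner_eq : ∀ u : L.domain, ⟪(u : H), L u⟫_ℂ = ((∫ t, (t : ℝ) ∂(P.measure (u : H)) : ℝ) : ℂ)

/-- The `k`-th moment `∫ λ^k d‖P(λ) u‖²`, an element of `[0, ∞]`. -/
def moment (k : ℕ) (u : H) : ℝ≥0∞ := ∫⁻ t, (t : ℝ≥0∞) ^ k ∂(P.measure u)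

end ProjectionValuedMeasure

end Spectral

namespace Network

variable {G : Type*}

/-- The Friedrichs extension of the Laplacian on the energy space. -/
def friedrichsLaplacian (N : Network G) (o : G) : N.EnergySpace →ₗ.[ℂ] N.EnergySpace :=
  friedrichsExtension (N.laplacian o) (N.laplacian_nonneg o)

variable {b c : Network G}

theorem FiniteEnergy.mono (h : ∀ x y, b.cond x y ≤ c.cond x y) {u : G → ℂ}
    (hu : c.FiniteEnergy u) : b.FiniteEnergy u :=
  Summable.of_nonneg_of_le (fun _ => mul_nonneg (b.nonneg _ _) (sq_nonneg _))
    (fun _ => mul_le_mul_of_nonneg_right (h _ _) (sq_nonneg _)) hu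

/-- The inclusion of energy spaces `H_c → H_b`, `u ↦ u`, for `b ≤ c`. -/
def inclusion (h : ∀ x y, b.cond x y ≤ c.cond x y) : c.EnergySpace →L[ℂ] b.EnergySpace :=
  LinearMap.mkContinuous
    (c.lift (b.toEnergy.comp (Submodule.inclusion
        (show c.energyDomain ≤ b.energyDomain from fun _ hu => FiniteEnergy.mono h hu)))
      (by
        intro u hu
        obtain ⟨k, hk⟩ := (c.mem_constants u).1 hu
        exact (Submodule.Quotient.mk_eq_zero b.constants).2 ((b.mem_constants _).2 ⟨k, hk⟩)))
    1 (by
      intro u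
      obtain ⟨u, rfl⟩ := c.mk_surjective u
      rw [one_mul, lift_mk, ← norm_grad, ← norm_grad]
      refine lp.norm_le_of_tsum_le (by norm_num) (norm_nonneg _) ?_
      rw [lp.norm_rpow_eq_tsum (by norm_num)]
      have hb := (lp.memℓp (b.grad (b.toEnergy (Submodule.inclusion
        (show c.energyDomain ≤ b.energyDomain from
          fun _ hu => FiniteEnergy.mono h hu) u)))).summable (by norm_num)
      have hc := (lp.memℓp (c.grad (c.toEnergy u))).summable (by norm_num)
      refine hb.tsum_le_tsum (fun p => ?_) hc
      simp only [ENNReal.toReal_ofNat, Real.rpow_ofNat]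
      refine (b.norm_gradFun_sq u p).trans_le (le_trans ?_ (c.norm_gradFun_sq u p).ge)
      have := h p.1 p.2
      gcongr)

theorem inclusion_mk (h : ∀ x y, b.cond x y ≤ c.cond x y) (u : c.energyDomain) :
    inclusion h (c.toEnergy u) = b.toEnergy ⟨(u : G → ℂ), FiniteEnergy.mono h u.2⟩ := rfl

end Network

end

/-!
The Friedrichs extension `L` of the network Laplacian can be computed explicitly: its form domain
consists of the `u` with `Δ u ∈ ℓ²`, its domain of the `u` for which `Δ u` lies in `ℓ²` and has
finite energy, and `L u = Δ u` there, with `⟪v, L u⟫ = ⟪Δ v, Δ u⟫` in `ℓ²`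
(`Network.mem_formDomain_iff`, `Network.mem_friedrichs_domain_iff`,
`Network.inner_friedrichsLaplacian`). The point is that the span of the energy kernel is dense in
the graph `{(u, Δ u)}`, taken in the Hilbert sum of the energy space and `ℓ²`. An element orthogonal
to the kernel has `u + Δ u` constant, so that `g = Δ u ∈ ℓ²` solves `g + Δ g = 0`, and such a `g`
vanishes by the maximum principle (`Network.eq_zero_of_add_lap_eq_zero`).

For a spectral resolution of `L` the first moment of `u` is therefore `∑ |Δ u(x)|²`, with value `∞`
allowed (`Network.moment_one_eq`), and the second moment is `‖L u‖²`, the energy of `Δ u`, for `u`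
in the domain of `L`, and `∞` otherwise
(`ProjectionValuedMeasure.IsSpectralResolution.moment_two`). As `Δ u(x) = ⟪δ_x, u⟫` and the
inclusion `I` maps `δ_x` to `δ_x`, the functions `Δ_c (I* u)` and `Δ_b u` agree
(`Network.lapE_adjoint_inclusion`). Hence the first moments agree, and the second moments are
energies of one function with respect to `b` and to `c`.

The spectral resolution of `L` is obtained from its resolvent `R = (1 + L)⁻¹ = π π*`, where `π` is
the projection of the graph to the energy space. The continuous functional calculus of `R` and the
Riesz–Markov–Kakutani theorem give a measure `μ_u` for each vector `u`, the map `f ↦ f(R) u` extends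
to an isometry from `L²(μ_u)` to the energy space, and the images of the indicator functions are the
spectral projections applied to `u`. They depend linearly on `u` since an indicator function is
approximated by continuous functions in finitely many of the measures simultaneously
(`StarAlgHom.exists_common_approx`). The spectral resolution of `L` is the image of the one of `R`
under `t ↦ 1 / t - 1` (`StarAlgHom.isSpectralResolution`).
-/

noncomputable section BorelCalculus

/-! ### Borel functional calculus -/

open scoped CompactlySupported

section SquareIntegrable

theorem abs_indicator_one_le {X : Type*} (B : Set X) (x : X) : |B.indicator (1 : X → ℝ) x| ≤ 1 := by
  by_cases hx : x ∈ B <;> simp [hx]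

variable {X : Type*} [MeasurableSpace X]

theorem norm_toLp_sq {g : X → ℝ} {μ : Measure X} (hg : MemLp g 2 μ) :
    ‖hg.toLp g‖ ^ 2 = ∫ x, g x ^ 2 ∂μ := by
  rw [@norm_sq_eq_re_inner ℝ, L2.inner_def]
  refine (integral_congr_ae ?_)
  filter_upwards [hg.coeFn_toLp] with x hx
  simp [hx, sq]

theorem integral_sub_sq_tendsto_of_le {ι : Type*} {l : Filter ι} {g : ι → X → ℝ} {k : X → ℝ}
    {μ ν : Measure X} (hμν : μ ≤ ν) (hg : ∀ n, MemLp (g n) 2 ν) (hk : MemLp k 2 ν)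
    (h : Tendsto (fun n => ∫ x, (g n x - k x) ^ 2 ∂ν) l (𝓝 0)) :
    Tendsto (fun n => ∫ x, (g n x - k x) ^ 2 ∂μ) l (𝓝 0) :=
  squeeze_zero (fun _ => integral_nonneg fun _ => sq_nonneg _)
    (fun n => integral_mono_measure hμν (ae_of_all _ fun _ => sq_nonneg _)
      ((hg n).sub hk).integrable_sq) h

theorem integral_mul_sub_sq_tendsto {ι : Type*} {l : Filter ι} {g : ι → X → ℝ} {k m : X → ℝ}
    {μ : Measure X} {C : ℝ} (hm : ∀ x, |m x| ≤ C)
    (hg : ∀ n, MemLp (g n) 2 μ) (hk : MemLp k 2 μ)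
    (h : Tendsto (fun n => ∫ x, (g n x - k x) ^ 2 ∂μ) l (𝓝 0)) :
    Tendsto (fun n => ∫ x, (m x * g n x - m x * k x) ^ 2 ∂μ) l (𝓝 0) := by
  refine squeeze_zero (g := fun n => C ^ 2 * ∫ x, (g n x - k x) ^ 2 ∂μ)
    (fun n => integral_nonneg fun x => sq_nonneg _) (fun n => ?_)
    (by simpa using h.const_mul (C ^ 2))
  rw [← integral_const_mul]
  refine integral_mono_of_nonneg (ae_of_all _ fun x => sq_nonneg _)
    (((hg n).sub hk).integrable_sq.const_mul _) (ae_of_all _ fun x => ?_)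
  change (m x * g n x - m x * k x) ^ 2 ≤ C ^ 2 * (g n x - k x) ^ 2
  rw [← mul_sub, mul_pow]
  exact mul_le_mul_of_nonneg_right (sq_le_sq' (abs_le.1 (hm x)).1 (abs_le.1 (hm x)).2) (sq_nonneg _)

theorem memLp_of_abs_le {g : X → ℝ} (hg : Measurable g) {C : ℝ} (hC : ∀ x, |g x| ≤ C)
    (μ : Measure X) [IsFiniteMeasure μ] : MemLp g 2 μ :=
  MemLp.of_bound hg.aestronglyMeasurable C (ae_of_all _ hC)

theorem memLp_mul {g m : X → ℝ} {μ : Measure X} (hm : Measurable m) {C : ℝ} (hC : ∀ x, |m x| ≤ C)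
    (hg : MemLp g 2 μ) : MemLp (fun x => m x * g x) 2 μ := by
  refine (hg.const_mul C).mono (hm.aestronglyMeasurable.mul hg.1) (ae_of_all _ fun x => ?_)
  simp only [norm_mul, Real.norm_eq_abs]
  exact mul_le_mul_of_nonneg_right ((hC x).trans (le_abs_self C)) (abs_nonneg _)

theorem measurable_indicator_one {B : Set X} (hB : MeasurableSet B) :
    Measurable (B.indicator (1 : X → ℝ)) := measurable_one.indicator hB

variable [MetricSpace X] [CompactSpace X] [BorelSpace X]

theorem memLp_continuousMap (f : C(X, ℝ)) (μ : Measure X) [IsFiniteMeasure μ] : MemLp f 2 μ :=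
  f.continuous.memLp_of_hasCompactSupport (HasCompactSupport.of_compactSpace _)

theorem exists_tendsto_integral_sub_sq {g : X → ℝ} {μ : Measure X} [IsFiniteMeasure μ]
    (hg : MemLp g 2 μ) : ∃ f : ℕ → C(X, ℝ),
      Tendsto (fun n => ∫ x, (f n x - g x) ^ 2 ∂μ) atTop (𝓝 0) := by
  have hd : DenseRange (ContinuousMap.toLp (E := ℝ) 2 μ ℝ) :=
    ContinuousMap.toLp_denseRange ℝ _ ℝ (by norm_num)
  obtain ⟨s, hs, hs'⟩ := mem_closure_iff_seq_limit.1 (hd (hg.toLp g))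
  choose f hf using hs
  refine ⟨f, ?_⟩
  rw [tendsto_iff_norm_sub_tendsto_zero] at hs'
  have h := hs'.pow 2
  rw [zero_pow two_ne_zero] at h
  refine h.congr fun n => ?_
  rw [← hf n]
  change ‖(memLp_continuousMap (f n) μ).toLp (f n) - hg.toLp g‖ ^ 2 = _
  rw [← MemLp.toLp_sub, norm_toLp_sq]
  rfl

end SquareIntegrable

namespace StarAlgHom

section Hom

variable {X : Type*} [TopologicalSpace X]
variable {H : Type*} [NormedAddCommGroup H] [InnerProductSpace ℂ H] [CompleteSpace H]
variable (Φ : C(X, ℝ) →⋆ₐ[ℝ] (H →L[ℂ] H))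

theorem inner_apply_left (f : C(X, ℝ)) (u v : H) : ⟪Φ f u, v⟫_ℂ = ⟪u, Φ f v⟫_ℂ := by
  have h : ContinuousLinearMap.adjoint (Φ f) = Φ f := by
    rw [← ContinuousLinearMap.star_eq_adjoint, ← map_star, star_trivial]
  rw [← ContinuousLinearMap.adjoint_inner_right, h]

theorem map_mul_apply (f g : C(X, ℝ)) (u : H) : Φ (f * g) u = Φ f (Φ g u) := by
  rw [map_mul]; rfl

end Hom

variable {X : Type*} [MetricSpace X] [CompactSpace X] [MeasurableSpace X] [BorelSpace X]
variable {H : Type*} [NormedAddCommGroup H] [InnerProductSpace ℂ H] [CompleteSpace H]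
variable (Φ : C(X, ℝ) →⋆ₐ[ℝ] (H →L[ℂ] H))

/-- The positive functional `f ↦ ⟪u, Φ(f) u⟫` on the continuous functions. -/
def vectorFunctional (u : H) : C_c(X, ℝ) →ₚ[ℝ] ℝ :=
  PositiveLinearMap.mk₀
    { toFun := fun f => (⟪u, Φ f.toContinuousMap u⟫_ℂ).re
      map_add' := fun f g => by
        have : (f + g).toContinuousMap = f.toContinuousMap + g.toContinuousMap := rfl
        simp [this]
      map_smul' := fun a f => by
        have : (a • f).toContinuousMap = a • f.toContinuousMap := rfl
        simp [this, inner_smul_right_eq_smul] }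
    (fun f hf => by
      -- a nonnegative function is a square, and `⟪u, Φ(g²) u⟫ = ‖Φ(g) u‖²`
      let g : C(X, ℝ) := ⟨fun x => Real.sqrt (f x), by fun_prop⟩
      have hg : f.toContinuousMap = g * g := by
        ext x
        exact (Real.mul_self_sqrt (hf x)).symm
      simp only [LinearMap.coe_mk, AddHom.coe_mk]
      rw [hg, map_mul_apply, ← inner_apply_left]
      exact inner_self_nonneg (𝕜 := ℂ))

/-- The spectral measure of `u`: the measure with `∫ f dμ_u = ⟪u, Φ(f) u⟫` for all continuous
`f`. -/
def vectorMeasure (u : H) : Measure X := RealRMK.rieszMeasure (Φ.vectorFunctional u)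

instance (u : H) : IsFiniteMeasure (Φ.vectorMeasure u) := by
  unfold vectorMeasure; infer_instance

theorem integral_vectorMeasure (u : H) (f : C(X, ℝ)) :
    ∫ x, f x ∂(Φ.vectorMeasure u) = (⟪u, Φ f u⟫_ℂ).re :=
  RealRMK.integral_rieszMeasure (Φ.vectorFunctional u)
    (CompactlySupportedContinuousMap.continuousMapEquiv f)

theorem norm_apply_sq (f : C(X, ℝ)) (u : H) :
    ‖Φ f u‖ ^ 2 = ∫ x, f x ^ 2 ∂(Φ.vectorMeasure u) := by
  have h := Φ.integral_vectorMeasure u (f * f)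
  rw [map_mul_apply, ← inner_apply_left] at h
  rw [@norm_sq_eq_re_inner ℂ]
  simpa [sq] using h.symm

/-- The spectral measure of `Φ(f) u` is `f² μ_u`. -/
theorem vectorMeasure_apply (f : C(X, ℝ)) (u : H) :
    Φ.vectorMeasure (Φ f u)
      = (Φ.vectorMeasure u).withDensity fun x => ENNReal.ofReal (f x ^ 2) := by
  have hf : Continuous fun x => f x ^ 2 := by fun_prop
  have hi : Integrable (fun x => f x ^ 2) (Φ.vectorMeasure u) :=
    (ContinuousMap.mk _ hf).continuous.integrable_of_hasCompactSupport
      (HasCompactSupport.of_compactSpace _)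
  have : IsFiniteMeasure ((Φ.vectorMeasure u).withDensity fun x => ENNReal.ofReal (f x ^ 2)) :=
    isFiniteMeasure_withDensity_ofReal hi.2
  refine ext_of_forall_integral_eq_of_IsFiniteMeasure fun k => ?_
  rw [integral_withDensity_eq_integral_toReal_smul (by fun_prop) (by simp)]
  have h1 := Φ.integral_vectorMeasure (Φ f u) k.toContinuousMap
  have h2 := Φ.integral_vectorMeasure u (f * (k.toContinuousMap * f))
  rw [map_mul_apply, map_mul_apply, ← inner_apply_left] at h2
  refine h1.trans (h2.symm.trans (integral_congr_ae (ae_of_all _ fun x => ?_)))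
  simp only [ContinuousMap.mul_apply, BoundedContinuousFunction.coe_toContinuousMap, smul_eq_mul,
    ENNReal.toReal_ofReal (sq_nonneg (f x))]
  ring

/-- The isometry from `L²(μ_u)` to `H` which maps a continuous function `f` to `Φ(f) u`. -/
def cyclicMap (u : H) : Lp ℝ 2 (Φ.vectorMeasure u) →L[ℝ] H :=
  LinearMap.extendOfNorm
    (E := C(X, ℝ))
    { toFun := fun f => Φ f u
      map_add' := fun f g => by simp
      map_smul' := fun a f => by simp }
    (ContinuousMap.toLp 2 (Φ.vectorMeasure u) ℝ).toLinearMap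

theorem cyclicMap_toLp (u : H) (f : C(X, ℝ)) :
    Φ.cyclicMap u ((memLp_continuousMap f (Φ.vectorMeasure u)).toLp f) = Φ f u := by
  refine LinearMap.extendOfNorm_eq (f := { toFun := fun f : C(X, ℝ) => Φ f u
                                           map_add' := fun f g => by simp
                                           map_smul' := fun a f => by simp })
    (e := (ContinuousMap.toLp 2 (Φ.vectorMeasure u) ℝ).toLinearMap)
    (ContinuousMap.toLp_denseRange ℝ _ ℝ (by norm_num)) ⟨1, fun g => ?_⟩ f
  rw [one_mul]
  refine (sq_le_sq₀ (norm_nonneg _) (norm_nonneg _)).1 (le_of_eq ?_)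
  exact (Φ.norm_apply_sq g u).trans (norm_toLp_sq (memLp_continuousMap g _)).symm

theorem norm_cyclicMap (u : H) (g : Lp ℝ 2 (Φ.vectorMeasure u)) : ‖Φ.cyclicMap u g‖ = ‖g‖ := by
  refine (ContinuousMap.toLp_denseRange ℝ (Φ.vectorMeasure u) ℝ (by norm_num)).induction
    (P := fun g => ‖Φ.cyclicMap u g‖ = ‖g‖) ?_ (isClosed_eq (by fun_prop) (by fun_prop)) g
  rintro _ ⟨f, rfl⟩
  refine (sq_eq_sq₀ (norm_nonneg _) (norm_nonneg _)).1 ?_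
  have h := Φ.norm_apply_sq f u
  rw [← Φ.cyclicMap_toLp u f, ← norm_toLp_sq (memLp_continuousMap f _)] at h
  exact h

open Classical in
/-- The vector `∫ g dE u` for a Borel function `g` which is square integrable with respect to the
spectral measure of `u`; it is `Φ(g) u` if `g` is continuous, and `0` by convention if `g` is not
square integrable. -/
def borel (g : X → ℝ) (u : H) : H :=
  if h : MemLp g 2 (Φ.vectorMeasure u) then Φ.cyclicMap u (h.toLp g) else 0

variable {Φ}

theorem borel_of_memLp {g : X → ℝ} {u : H} (h : MemLp g 2 (Φ.vectorMeasure u)) :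
    Φ.borel g u = Φ.cyclicMap u (h.toLp g) := dif_pos h

theorem borel_continuousMap (f : C(X, ℝ)) (u : H) : Φ.borel f u = Φ f u := by
  rw [borel_of_memLp (memLp_continuousMap f _), Φ.cyclicMap_toLp u f]

theorem norm_borel_sq {g : X → ℝ} {u : H} (h : MemLp g 2 (Φ.vectorMeasure u)) :
    ‖Φ.borel g u‖ ^ 2 = ∫ x, g x ^ 2 ∂(Φ.vectorMeasure u) := by
  rw [borel_of_memLp h, norm_cyclicMap, norm_toLp_sq]

theorem borel_sub {g k : X → ℝ} {u : H} (hg : MemLp g 2 (Φ.vectorMeasure u))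
    (hk : MemLp k 2 (Φ.vectorMeasure u)) : Φ.borel (g - k) u = Φ.borel g u - Φ.borel k u := by
  rw [borel_of_memLp hg, borel_of_memLp hk, borel_of_memLp (hg.sub hk), MemLp.toLp_sub hg hk,
    map_sub]

theorem borel_congr {g k : X → ℝ} {u : H} (hg : MemLp g 2 (Φ.vectorMeasure u))
    (h : g =ᵐ[Φ.vectorMeasure u] k) : Φ.borel g u = Φ.borel k u := by
  rw [borel_of_memLp hg, borel_of_memLp (hg.ae_eq h)]
  congr 1
  exact MemLp.toLp_congr _ _ h

theorem tendsto_borel {g : ℕ → X → ℝ} {k : X → ℝ} {u : H}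
    (hg : ∀ n, MemLp (g n) 2 (Φ.vectorMeasure u)) (hk : MemLp k 2 (Φ.vectorMeasure u))
    (h : Tendsto (fun n => ∫ x, (g n x - k x) ^ 2 ∂(Φ.vectorMeasure u)) atTop (𝓝 0)) :
    Tendsto (fun n => Φ.borel (g n) u) atTop (𝓝 (Φ.borel k u)) := by
  rw [tendsto_iff_norm_sub_tendsto_zero]
  have h1 : ∀ n, ‖Φ.borel (g n) u - Φ.borel k u‖
      = Real.sqrt (∫ x, (g n x - k x) ^ 2 ∂(Φ.vectorMeasure u)) := fun n => by
    rw [← borel_sub (hg n) hk, ← Real.sqrt_sq (norm_nonneg (Φ.borel (g n - k) u)),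
      norm_borel_sq ((hg n).sub hk)]
    rfl
  simp only [h1]
  simpa using h.sqrt

/-- Multiplicativity, `Φ(f) (∫ g dE u) = ∫ f g dE u`, for continuous `f`. Here `g` may be
unbounded. -/
theorem apply_borel (f : C(X, ℝ)) {g : X → ℝ} {u : H} (hg : MemLp g 2 (Φ.vectorMeasure u)) :
    Φ f (Φ.borel g u) = Φ.borel (fun x => f x * g x) u := by
  obtain ⟨k, hk⟩ := exists_tendsto_integral_sub_sq hg
  have hkm := fun n => memLp_continuousMap (k n) (Φ.vectorMeasure u)
  have h1 := ((Φ f).continuous.tendsto _).comp (tendsto_borel hkm hg hk)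
  have h2 := tendsto_borel (fun n => memLp_mul f.continuous.measurable (f.norm_coe_le_norm) (hkm n))
    (memLp_mul f.continuous.measurable (f.norm_coe_le_norm) hg)
    (integral_mul_sub_sq_tendsto (f.norm_coe_le_norm) hkm hg hk)
  refine tendsto_nhds_unique h1 (h2.congr fun n => ?_)
  simp only [Function.comp, borel_continuousMap, ← map_mul_apply]
  exact borel_continuousMap (f * k n) u

/-- A bounded Borel function is approximated by continuous functions in the spectral measures of
finitely many vectors simultaneously, which makes `u ↦ ∫ g dE u` linear. -/
theorem exists_common_approx {g : X → ℝ} (hg : Measurable g) {C : ℝ} (hC : ∀ x, |g x| ≤ C)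
    (s : Finset H) : ∃ f : ℕ → C(X, ℝ), ∀ u ∈ s,
      Tendsto (fun n => ∫ x, (f n x - g x) ^ 2 ∂(Φ.vectorMeasure u)) atTop (𝓝 0) ∧
      Tendsto (fun n => Φ (f n) u) atTop (𝓝 (Φ.borel g u)) := by
  obtain ⟨f, hf⟩ := exists_tendsto_integral_sub_sq
    (memLp_of_abs_le hg hC (∑ u ∈ s, Φ.vectorMeasure u))
  refine ⟨f, fun u hu => ?_⟩
  have h := integral_sub_sq_tendsto_of_le
    (show Φ.vectorMeasure u ≤ _ from Measure.le_intro fun A _ _ => by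
      rw [Measure.finsetSum_apply]
      exact Finset.single_le_sum (f := fun v => Φ.vectorMeasure v A) (by simp) hu)
    (fun n => memLp_continuousMap (f n) _) (memLp_of_abs_le hg hC _) hf
  refine ⟨h, ?_⟩
  simpa only [borel_continuousMap] using
    tendsto_borel (fun n => memLp_continuousMap (f n) _) (memLp_of_abs_le hg hC _) h

open Classical in
theorem borel_add {g : X → ℝ} (hg : Measurable g) {C : ℝ} (hC : ∀ x, |g x| ≤ C) (u v : H) :
    Φ.borel g (u + v) = Φ.borel g u + Φ.borel g v := by
  obtain ⟨f, hf⟩ := exists_common_approx (Φ := Φ) hg hC {u, v, u + v}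
  refine tendsto_nhds_unique (hf (u + v) (by simp)).2
    (((hf u (by simp)).2.add (hf v (by simp)).2).congr fun n => (map_add _ _ _).symm)

open Classical in
theorem borel_smul {g : X → ℝ} (hg : Measurable g) {C : ℝ} (hC : ∀ x, |g x| ≤ C) (a : ℂ) (u : H) :
    Φ.borel g (a • u) = a • Φ.borel g u := by
  obtain ⟨f, hf⟩ := exists_common_approx (Φ := Φ) hg hC {u, a • u}
  refine tendsto_nhds_unique (hf (a • u) (by simp)).2
    (((hf u (by simp)).2.const_smul a).congr fun n => (map_smul _ _ _).symm)

open Classical in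
theorem inner_borel_left {g : X → ℝ} (hg : Measurable g) {C : ℝ} (hC : ∀ x, |g x| ≤ C) (u v : H) :
    ⟪Φ.borel g u, v⟫_ℂ = ⟪u, Φ.borel g v⟫_ℂ := by
  obtain ⟨f, hf⟩ := exists_common_approx (Φ := Φ) hg hC {u, v}
  refine tendsto_nhds_unique ((hf u (by simp)).2.inner tendsto_const_nhds)
    ((tendsto_const_nhds.inner (hf v (by simp)).2).congr fun n => ?_)
  exact (Φ.inner_apply_left _ _ _).symm

open Classical in
theorem borel_borel {g k : X → ℝ} (hg : Measurable g) {C : ℝ} (hC : ∀ x, |g x| ≤ C)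
    (hk : Measurable k) {D : ℝ} (hD : ∀ x, |k x| ≤ D) (u : H) :
    Φ.borel k (Φ.borel g u) = Φ.borel (fun x => g x * k x) u := by
  obtain ⟨f, hf⟩ := exists_common_approx (Φ := Φ) hk hD {u, Φ.borel g u}
  have hfm := fun n => memLp_continuousMap (f n) (Φ.vectorMeasure u)
  have hkm := memLp_of_abs_le hk hD (Φ.vectorMeasure u)
  refine tendsto_nhds_unique (hf (Φ.borel g u) (by simp)).2
    ((tendsto_borel (fun n => memLp_mul hg hC (hfm n)) (memLp_mul hg hC hkm)
      (integral_mul_sub_sq_tendsto hC hfm hkm (hf u (by simp)).1)).congr fun n => ?_)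
  rw [apply_borel _ (memLp_of_abs_le hg hC _)]
  simp only [mul_comm]

theorem norm_borel_indicator_sq {B : Set X} (hB : MeasurableSet B) (u : H) :
    ‖Φ.borel (B.indicator 1) u‖ ^ 2 = (Φ.vectorMeasure u).real B := by
  rw [norm_borel_sq (memLp_of_abs_le (measurable_indicator_one hB) (abs_indicator_one_le B) _),
    ← integral_indicator_one hB]
  congr 1
  funext x
  by_cases hx : x ∈ B <;> simp [hx]

variable (Φ) in
/-- The spectral projection of a set `B`: the operator `u ↦ ∫ 1_B dE u`, and `0` by convention if
`B` is not measurable. -/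
def spectralProj (B : Set X) : H →L[ℂ] H :=
  open Classical in
  if hB : MeasurableSet B then
    LinearMap.mkContinuous
      { toFun := Φ.borel (B.indicator 1)
        map_add' := borel_add (measurable_indicator_one hB) (abs_indicator_one_le B)
        map_smul' := borel_smul (measurable_indicator_one hB) (abs_indicator_one_le B) }
      1 (fun u => by
        rw [one_mul]
        refine (sq_le_sq₀ (norm_nonneg _) (norm_nonneg _)).1 ?_
        have h1 := norm_borel_indicator_sq (Φ := Φ) hB u
        have h2 := norm_apply_sq Φ 1 u
        simp only [map_one, one_apply_eq_self, ContinuousMap.one_apply, one_pow,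
          integral_const, smul_eq_mul, mul_one] at h2
        refine h1.trans_le ?_
        rw [h2]
        exact measureReal_mono (Set.subset_univ B))
  else 0

theorem spectralProj_apply {B : Set X} (hB : MeasurableSet B) (u : H) :
    Φ.spectralProj B u = Φ.borel (B.indicator 1) u := by
  rw [spectralProj, dif_pos hB]; rfl

theorem spectralProj_inter {A B : Set X} (hA : MeasurableSet A) (hB : MeasurableSet B) :
    Φ.spectralProj (A ∩ B) = Φ.spectralProj A * Φ.spectralProj B := by
  ext u
  rw [mul_apply_eq_comp, spectralProj_apply (hA.inter hB), spectralProj_apply hA,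
    spectralProj_apply hB, borel_borel (measurable_indicator_one hB) (abs_indicator_one_le B)
    (measurable_indicator_one hA) (abs_indicator_one_le A)]
  congr 1
  rw [Set.inter_comm, Set.inter_indicator_one]
  rfl

theorem spectralProj_univ : Φ.spectralProj Set.univ = 1 := by
  ext u
  rw [spectralProj_apply MeasurableSet.univ, Set.indicator_univ]
  exact (borel_continuousMap 1 u).trans (by simp)

theorem isStarProjection_spectralProj {B : Set X} (hB : MeasurableSet B) :
    IsStarProjection (Φ.spectralProj B) := by
  refine ⟨?_, ?_⟩
  · rw [IsIdempotentElem, ← spectralProj_inter hB hB, Set.inter_self]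
  · rw [ContinuousLinearMap.isSelfAdjoint_iff_isSymmetric]
    intro u v
    change ⟪Φ.spectralProj B u, v⟫_ℂ = ⟪u, Φ.spectralProj B v⟫_ℂ
    rw [spectralProj_apply hB, spectralProj_apply hB]
    exact inner_borel_left (measurable_indicator_one hB) (abs_indicator_one_le B) u v

theorem spectralProj_diff {U V : Set X} (hU : MeasurableSet U) (hV : MeasurableSet V)
    (h : V ⊆ U) (u : H) :
    Φ.spectralProj (U \ V) u = Φ.spectralProj U u - Φ.spectralProj V u := by
  have hm : ∀ {A : Set X}, MeasurableSet A →
      MemLp (A.indicator (1 : X → ℝ)) 2 (Φ.vectorMeasure u) := fun hA =>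
    memLp_of_abs_le (measurable_indicator_one hA) (abs_indicator_one_le _) _
  rw [spectralProj_apply (hU.diff hV), spectralProj_apply hU, spectralProj_apply hV,
    ← borel_sub (hm hU) (hm hV), Set.indicator_sdiff h]

theorem norm_spectralProj_sq {B : Set X} (hB : MeasurableSet B) (u : H) :
    ‖Φ.spectralProj B u‖ ^ 2 = (Φ.vectorMeasure u).real B := by
  rw [spectralProj_apply hB, norm_borel_indicator_sq hB]

theorem sum_spectralProj {B : ℕ → Set X} (hB : ∀ n, MeasurableSet (B n))
    (hd : Pairwise (Function.onFun Disjoint B)) (s : Finset ℕ) (u : H) :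
    ∑ n ∈ s, Φ.spectralProj (B n) u = Φ.spectralProj (⋃ n ∈ s, B n) u := by
  classical
  induction s using Finset.induction_on with
  | empty =>
    have h := spectralProj_diff (Φ := Φ) MeasurableSet.empty MeasurableSet.empty subset_rfl u
    simpa using h.symm
  | insert n s hn ih =>
    have hs : MeasurableSet (⋃ k ∈ s, B k) := Finset.measurableSet_biUnion s fun k _ => hB k
    have hdis : Disjoint (B n) (⋃ k ∈ s, B k) := by
      simp only [Set.disjoint_iUnion_right]
      exact fun k hk => hd fun h => hn (h ▸ hk)
    have h := spectralProj_diff (Φ := Φ) ((hB n).union hs) hs Set.subset_union_right u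
    rw [Set.union_sdiff_right, hdis.sdiff_eq_left] at h
    rw [Finset.sum_insert hn, ih, Finset.set_biUnion_insert, h, sub_add_cancel]

/-- Countable additivity: the squared norm of the remainder is the mass which the measure `μ_u`
leaves to the remaining sets. -/
theorem hasSum_spectralProj (B : ℕ → Set X) (hB : ∀ n, MeasurableSet (B n))
    (hd : Pairwise (Function.onFun Disjoint B)) (u : H) :
    HasSum (fun n => Φ.spectralProj (B n) u) (Φ.spectralProj (⋃ n, B n) u) := by
  have hU := MeasurableSet.iUnion hB
  have hs : ∀ s : Finset ℕ, MeasurableSet (⋃ n ∈ s, B n) := fun s =>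
    Finset.measurableSet_biUnion s fun k _ => hB k
  have h1 : ∀ s : Finset ℕ, ‖∑ n ∈ s, Φ.spectralProj (B n) u - Φ.spectralProj (⋃ n, B n) u‖ ^ 2
      = (Φ.vectorMeasure u).real (⋃ n, B n) - ∑ n ∈ s, (Φ.vectorMeasure u).real (B n) := by
    intro s
    have hsub : (⋃ n ∈ s, B n) ⊆ ⋃ n, B n := Set.iUnion₂_subset_iUnion _ _
    rw [sum_spectralProj hB hd, norm_sub_rev, ← spectralProj_diff hU (hs s) hsub,
      norm_spectralProj_sq (hU.diff (hs s)), measureReal_sdiff hsub (hs s),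
      measureReal_biUnion_finset (fun i _ j _ hij => hd hij) fun k _ => hB k]
  have h2 : HasSum (fun n => (Φ.vectorMeasure u).real (B n))
      ((Φ.vectorMeasure u).real (⋃ n, B n)) := by
    have h := measure_iUnion (μ := Φ.vectorMeasure u) hd hB
    have hne : ∑' n, Φ.vectorMeasure u (B n) ≠ ∞ := h ▸ measure_ne_top _ _
    have h3 := (ENNReal.summable_toReal hne).hasSum
    rwa [← ENNReal.tsum_toReal_eq fun n => measure_ne_top _ _, ← h] at h3
  have h3 : Tendsto (fun s : Finset ℕ =>
      ‖∑ n ∈ s, Φ.spectralProj (B n) u - Φ.spectralProj (⋃ n, B n) u‖ ^ 2) atTop (𝓝 0) := by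
    simp only [h1]
    have h4 : Tendsto (fun s : Finset ℕ => ∑ n ∈ s, (Φ.vectorMeasure u).real (B n)) atTop
      (𝓝 ((Φ.vectorMeasure u).real (⋃ n, B n))) := h2
    simpa using h4.const_sub ((Φ.vectorMeasure u).real (⋃ n, B n))
  refine tendsto_iff_norm_sub_tendsto_zero.2 ?_
  simpa [Real.sqrt_sq] using h3.sqrt

variable (Φ) in
/-- The image of the spectral measure of `Φ` under a Borel map to `[0, ∞)`. -/
def projectionValuedMeasure {φ : X → ℝ≥0} (hφ : Measurable φ) : ProjectionValuedMeasure H where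
  proj B := Φ.spectralProj (φ ⁻¹' B)
  isStarProjection _ hB := isStarProjection_spectralProj (hφ hB)
  proj_univ := spectralProj_univ
  proj_inter _ _ hA hB := spectralProj_inter (hφ hA) (hφ hB)
  hasSum_iUnion B hB hd u := by
    rw [Set.preimage_iUnion]
    exact hasSum_spectralProj _ (fun n => hφ (hB n)) (fun i j hij => (hd hij).preimage φ) u

theorem measure_projectionValuedMeasure {φ : X → ℝ≥0} (hφ : Measurable φ) (u : H) :
    (Φ.projectionValuedMeasure hφ).measure u = (Φ.vectorMeasure u).map φ := by
  ext B hB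
  rw [ProjectionValuedMeasure.measure_apply _ _ _ hB, Measure.map_apply hφ hB]
  change ENNReal.ofReal (‖Φ.spectralProj (φ ⁻¹' B) u‖ ^ 2) = _
  rw [norm_spectralProj_sq (hφ hB), ofReal_measureReal]

end StarAlgHom
end BorelCalculus

noncomputable section Resolvent

/-! ### The spectral theorem for the inverse of a contraction -/

variable {H : Type*} [NormedAddCommGroup H] [InnerProductSpace ℂ H] [CompleteSpace H]

theorem spectrum_real_subset_Icc {R : H →L[ℂ] H} (hR : 0 ≤ R) (hR' : ‖R‖ ≤ 1) {t : ℝ}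
    (ht : t ∈ spectrum ℝ R) : 0 ≤ t ∧ t ≤ 1 := by
  refine ⟨spectrum_nonneg_of_nonneg hR ht, (le_abs_self t).trans ?_⟩
  refine (spectrum.norm_le_norm_mul_of_mem ht).trans ?_
  exact mul_le_one₀ hR' (norm_nonneg _) ContinuousLinearMap.norm_id_le

theorem measurable_inv_sub_one {X : Type*} [MeasurableSpace X] {f : X → ℝ} (hf : Measurable f) :
    Measurable fun x => ((f x)⁻¹ - 1).toNNReal := by fun_prop

/-- If `Φ(ι) = (1 + L)⁻¹` for a continuous function `ι` with values in `[0, 1]`, then the image of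
the spectral measure of `Φ` under `1 / ι - 1` is a spectral resolution of `L`. -/
theorem StarAlgHom.isSpectralResolution {X : Type*} [MetricSpace X] [CompactSpace X]
    [MeasurableSpace X] [BorelSpace X] (Φ : C(X, ℝ) →⋆ₐ[ℝ] (H →L[ℂ] H)) (ι : C(X, ℝ))
    (h01 : ∀ t, 0 ≤ ι t ∧ ι t ≤ 1) (L : H →ₗ.[ℂ] H) (hinj : ∀ w, Φ ι w = 0 → w = 0)
    (hR : ∀ w, ∃ h : Φ ι w ∈ L.domain, L ⟨Φ ι w, h⟩ = w - Φ ι w)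
    (hdom : ∀ u ∈ L.domain, ∃ w, Φ ι w = u) :
    (Φ.projectionValuedMeasure
      (measurable_inv_sub_one ι.continuous.measurable)).IsSpectralResolution L := by
  let φ : X → ℝ≥0 := fun t => ((ι t)⁻¹ - 1).toNNReal
  have hφ : Measurable φ := measurable_inv_sub_one ι.continuous.measurable
  have hφ_coe : ∀ t, ι t ≠ 0 → (φ t : ℝ) = (ι t)⁻¹ - 1 := fun t ht =>
    Real.coe_toNNReal _
      (sub_nonneg.2 ((one_le_inv₀ (lt_of_le_of_ne (h01 t).1 ht.symm)).2 (h01 t).2))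
  -- both hold at zeros of `ι` as well, where `φ` is `0` because `0⁻¹ = 0`
  have hφ_mul : ∀ t, (φ t : ℝ) * ι t ≤ 1 ∧ (φ t : ℝ) * ι t ^ 2 = ι t - ι t ^ 2 := fun t => by
    rcases eq_or_ne (ι t) 0 with h0 | h0
    · simp [h0]
    · rw [hφ_coe t h0]
      constructor
      · rw [sub_mul, inv_mul_cancel₀ h0]; linarith [(h01 t).1]
      · field_simp
  -- the kernel of `Φ(ι)` is trivial, so that `0` is a null set for all spectral measures
  have hnull : ∀ u, ∀ᵐ t ∂(Φ.vectorMeasure u), ι t ≠ 0 := fun u => by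
    have hB : MeasurableSet {t | ι t = 0} :=
      measurableSet_eq_fun ι.continuous.measurable measurable_const
    have hz : Φ ι (Φ.borel (Set.indicator {t | ι t = 0} 1) u) = 0 := by
      rw [StarAlgHom.apply_borel ι (memLp_of_abs_le (measurable_indicator_one hB)
        (abs_indicator_one_le _) _)]
      have : (fun t => ι t * Set.indicator {t | ι t = 0} 1 t) = ((0 : C(X, ℝ)) : _ → ℝ) := by
        funext t
        by_cases ht : ι t = 0 <;> simp [ht]
      rw [this, StarAlgHom.borel_continuousMap, map_zero]; rfl
    have h := StarAlgHom.norm_borel_indicator_sq (Φ := Φ) hB u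
    rw [hinj _ hz, norm_zero, zero_pow two_ne_zero, eq_comm, measureReal_eq_zero_iff] at h
    rw [ae_iff]
    simpa using h
  refine ⟨?_, ?_⟩
  · intro u
    rw [StarAlgHom.measure_projectionValuedMeasure _ u, lintegral_map (by fun_prop) hφ]
    constructor
    · intro hu
      obtain ⟨w, rfl⟩ := hdom u hu
      rw [StarAlgHom.vectorMeasure_apply,
        lintegral_withDensity_eq_lintegral_mul _ (by fun_prop) (by fun_prop)]
      calc _ ≤ ∫⁻ _, 1 ∂(Φ.vectorMeasure w) := lintegral_mono fun t => by
            simp only [Pi.mul_apply]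
            rw [← ENNReal.ofReal_coe_nnreal, ← ENNReal.ofReal_pow (NNReal.coe_nonneg _),
              ← ENNReal.ofReal_mul (sq_nonneg _), ← mul_pow, ENNReal.ofReal_le_one]
            refine pow_le_one₀ (mul_nonneg (h01 t).1 (NNReal.coe_nonneg _)) ?_
            rw [mul_comm]; exact (hφ_mul t).1
        _ < ∞ := by simp
    · intro hu
      have hφL : MemLp (fun t => (φ t : ℝ)) 2 (Φ.vectorMeasure u) := by
        refine (memLp_two_iff_integrable_sq (by fun_prop)).2 ⟨by fun_prop, ?_⟩
        rw [hasFiniteIntegral_iff_ofReal (ae_of_all _ fun t => sq_nonneg _)]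
        refine lt_of_eq_of_lt (lintegral_congr fun t => ?_) hu
        rw [ENNReal.ofReal_pow (NNReal.coe_nonneg _), ENNReal.ofReal_coe_nnreal]
      -- `w = ∫ (1 / t) dE u` satisfies `Φ(ι) w = u`
      have hgL : MemLp (fun t => (φ t : ℝ) + 1) 2 (Φ.vectorMeasure u) :=
        hφL.add (memLp_const 1)
      have hw : Φ ι (Φ.borel (fun t => (φ t : ℝ) + 1) u) = u := by
        rw [StarAlgHom.apply_borel ι hgL]
        have h1 := StarAlgHom.borel_continuousMap (Φ := Φ) 1 u
        rw [map_one] at h1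
        refine (StarAlgHom.borel_congr (memLp_mul ι.continuous.measurable ι.norm_coe_le_norm hgL)
          ?_).trans h1
        filter_upwards [hnull u] with t ht
        rw [hφ_coe t ht, ContinuousMap.one_apply]
        field_simp
        ring
      exact hw ▸ (hR _).1
  · rintro ⟨u, hu⟩
    obtain ⟨w, rfl⟩ := hdom u hu
    obtain ⟨h, hL⟩ := hR w
    have h1 : ⟪Φ ι w, w - Φ ι w⟫_ℂ = ⟪w, Φ (ι - ι ^ 2) w⟫_ℂ := by
      rw [StarAlgHom.inner_apply_left, map_sub, map_sub, sq, map_mul]; rfl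
    rw [hL, h1]
    have him : (⟪w, Φ (ι - ι ^ 2) w⟫_ℂ).im = 0 := by
      have := inner_conj_symm (𝕜 := ℂ) w (Φ (ι - ι ^ 2) w)
      rw [StarAlgHom.inner_apply_left] at this
      exact Complex.conj_eq_iff_im.1 this
    rw [← Complex.re_add_im ⟪w, Φ (ι - ι ^ 2) w⟫_ℂ, him, ← StarAlgHom.integral_vectorMeasure,
      StarAlgHom.measure_projectionValuedMeasure]
    simp only [Complex.ofReal_zero, zero_mul, add_zero, Complex.ofReal_inj]
    rw [integral_map hφ.aemeasurable (by fun_prop)]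
    rw [StarAlgHom.vectorMeasure_apply, integral_withDensity_eq_integral_toReal_smul (by fun_prop)
      (by simp)]
    refine integral_congr_ae (ae_of_all _ fun t => ?_)
    simp only [ENNReal.toReal_ofReal (sq_nonneg _), smul_eq_mul]
    rw [mul_comm, (hφ_mul t).2]
    simp

/-- A nonnegative operator `L` whose resolvent `R = (1 + L)⁻¹` is everywhere defined has a
spectral resolution. -/
theorem exists_isSpectralResolution_of_resolvent (L : H →ₗ.[ℂ] H) (R : H →L[ℂ] H) (hpos : 0 ≤ R)
    (hle : ‖R‖ ≤ 1) (hinj : ∀ w, R w = 0 → w = 0)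
    (hR : ∀ w, ∃ h : R w ∈ L.domain, L ⟨R w, h⟩ = w - R w)
    (hdom : ∀ u ∈ L.domain, ∃ w, R w = u) :
    ∃ P : ProjectionValuedMeasure H, P.IsSpectralResolution L := by
  have hsa : IsSelfAdjoint R := IsSelfAdjoint.of_nonneg hpos
  have hι := cfcHom_id (R := ℝ) hsa
  refine ⟨_, StarAlgHom.isSpectralResolution (cfcHom (R := ℝ) hsa)
    ((ContinuousMap.id ℝ).restrict (spectrum ℝ R))
    (fun t => spectrum_real_subset_Icc hpos hle t.2) L ?_ ?_ ?_⟩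
  · simpa only [hι] using hinj
  · simpa only [hι] using hR
  · simpa only [hι] using hdom

end Resolvent

noncomputable section SpectralCalculus

/-! ### Moments of a spectral resolution -/

/-- Two measures on `[0, ∞)` with `a² μ(B) ≤ ν(B) ≤ b² μ(B)` for all `B ⊆ [a, b]` satisfy
`ν = t² μ`, in particular their total masses agree. -/
theorem lintegral_sq_eq_measure_univ {μ ν : Measure ℝ≥0}
    (hfin : ∫⁻ t, ((t + 1 : ℝ≥0) : ℝ≥0∞) ^ 2 ∂μ ≠ ∞)
    (h : ∀ (a b : ℝ≥0) (B : Set ℝ≥0), MeasurableSet B → B ⊆ Set.Icc a b →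
      (a : ℝ≥0∞) ^ 2 * μ B ≤ ν B ∧ ν B ≤ (b : ℝ≥0∞) ^ 2 * μ B) :
    ∫⁻ t, (t : ℝ≥0∞) ^ 2 ∂μ = ν Set.univ := by
  -- cut `[0, ∞)` into intervals of length `ε`
  have key : ∀ ε : ℝ≥0, 0 < ε → ∫⁻ t, ((t - ε : ℝ≥0) : ℝ≥0∞) ^ 2 ∂μ ≤ ν Set.univ ∧
      ν Set.univ ≤ ∫⁻ t, ((t + ε : ℝ≥0) : ℝ≥0∞) ^ 2 ∂μ := by
    intro ε hε
    let k : ℝ≥0 → ℕ := fun t => ⌊t / ε⌋₊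
    have hk : Measurable k := Nat.measurable_floor.comp (measurable_id.div_const ε)
    have hB : ∀ n : ℕ, MeasurableSet (k ⁻¹' {n}) := fun n => hk (measurableSet_singleton n)
    have hd : Pairwise (Function.onFun Disjoint fun n : ℕ => k ⁻¹' {n}) := fun m n hmn =>
      Disjoint.preimage k (Set.disjoint_singleton.2 hmn)
    have hU : (⋃ n : ℕ, k ⁻¹' {n}) = Set.univ := by
      rw [← Set.preimage_iUnion, Set.iUnion_of_singleton, Set.preimage_univ]
    have hI : ∀ n : ℕ, ∀ t ∈ k ⁻¹' {n}, (n : ℝ≥0) * ε ≤ t ∧ t ≤ ((n : ℝ≥0) + 1) * ε := by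
      intro n t ht
      have ht' : ⌊t / ε⌋₊ = n := ht
      constructor
      · rw [← le_div_iff₀ hε, ← ht']; exact Nat.floor_le zero_le
      · rw [← div_le_iff₀ hε, ← ht']; exact (Nat.lt_floor_add_one _).le
    have hlin : ∀ f : ℝ≥0 → ℝ≥0∞, ∫⁻ t, f t ∂μ = ∑' n : ℕ, ∫⁻ t in k ⁻¹' {n}, f t ∂μ := fun f => by
      rw [← lintegral_iUnion hB hd, hU, Measure.restrict_univ]
    have hν : ν Set.univ = ∑' n : ℕ, ν (k ⁻¹' {n}) := by rw [← hU, measure_iUnion hd hB]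
    rw [hν, hlin, hlin]
    refine ⟨ENNReal.tsum_le_tsum fun n => ?_, ENNReal.tsum_le_tsum fun n => ?_⟩
    · refine le_trans ?_ (h _ _ _ (hB n) (hI n)).1
      rw [← setLIntegral_const]
      refine setLIntegral_mono' (hB n) fun t ht => ?_
      gcongr
      rw [tsub_le_iff_right]
      exact (hI n t ht).2.trans_eq (by ring)
    · refine (h _ _ _ (hB n) (hI n)).2.trans ?_
      rw [← setLIntegral_const]
      refine setLIntegral_mono' (hB n) fun t ht => ?_
      gcongr
      rw [add_mul, one_mul]
      exact add_le_add_left (hI n t ht).1 ε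
  have hε : ∀ n : ℕ, (0 : ℝ≥0) < 1 / ((n : ℝ≥0) + 1) := fun n => by positivity
  have hlim : Tendsto (fun n : ℕ => 1 / ((n : ℝ≥0) + 1)) atTop (𝓝 0) :=
    tendsto_one_div_add_atTop_nhds_zero_nat
  refine le_antisymm ?_ ?_
  · refine le_of_tendsto' (f := fun n : ℕ => ∫⁻ t, ((t - 1 / ((n : ℝ≥0) + 1) : ℝ≥0) : ℝ≥0∞) ^ 2 ∂μ)
      (x := atTop) ?_ fun n => (key _ (hε n)).1
    refine tendsto_lintegral_of_dominated_convergence' (fun t => ((t + 1 : ℝ≥0) : ℝ≥0∞) ^ 2)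
      (fun n => by fun_prop) (fun n => ae_of_all _ fun t => ?_) hfin (ae_of_all _ fun t => ?_)
    · beta_reduce
      gcongr
      exact tsub_le_self.trans le_self_add
    · refine (ENNReal.continuous_pow 2).tendsto _ |>.comp (ENNReal.tendsto_coe.2 ?_)
      simpa using (tendsto_const_nhds (x := t)).sub hlim
  · refine ge_of_tendsto' (f := fun n : ℕ => ∫⁻ t, ((t + 1 / ((n : ℝ≥0) + 1) : ℝ≥0) : ℝ≥0∞) ^ 2 ∂μ)
      (x := atTop) ?_ fun n => (key _ (hε n)).2
    refine tendsto_lintegral_of_dominated_convergence' (fun t => ((t + 1 : ℝ≥0) : ℝ≥0∞) ^ 2)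
      (fun n => by fun_prop) (fun n => ae_of_all _ fun t => ?_) hfin (ae_of_all _ fun t => ?_)
    · beta_reduce
      gcongr
      rw [div_le_one (by positivity)]
      exact le_add_self
    · refine (ENNReal.continuous_pow 2).tendsto _ |>.comp (ENNReal.tendsto_coe.2 ?_)
      simpa using (tendsto_const_nhds (x := t)).add hlim

namespace ProjectionValuedMeasure

variable {H : Type*} [NormedAddCommGroup H] [InnerProductSpace ℂ H] [CompleteSpace H]
variable {P : ProjectionValuedMeasure H} {L : H →ₗ.[ℂ] H}

theorem proj_proj {A B : Set ℝ≥0} (hA : MeasurableSet A) (hB : MeasurableSet B) (u : H) :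
    P.proj A (P.proj B u) = P.proj (A ∩ B) u := by
  rw [P.proj_inter A B hA hB]; rfl

theorem inner_proj_left {B : Set ℝ≥0} (hB : MeasurableSet B) (u v : H) :
    ⟪P.proj B u, v⟫_ℂ = ⟪u, P.proj B v⟫_ℂ :=
  (P.isStarProjection B hB).isSelfAdjoint.isSymmetric u v

theorem measure_proj {B : Set ℝ≥0} (hB : MeasurableSet B) (u : H) :
    P.measure (P.proj B u) = (P.measure u).restrict B := by
  ext A hA
  rw [Measure.restrict_apply hA, P.measure_apply _ _ hA, P.measure_apply _ _ (hA.inter hB),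
    proj_proj hA hB]

theorem measure_univ (u : H) : P.measure u Set.univ = ENNReal.ofReal (‖u‖ ^ 2) := by
  rw [P.measure_apply _ _ MeasurableSet.univ, P.proj_univ]; rfl

instance (u : H) : IsFiniteMeasure (P.measure u) := 
  ⟨by rw [measure_univ]; exact ENNReal.ofReal_lt_top⟩

theorem proj_empty (u : H) : P.proj ∅ u = 0 := by
  have h := P.measure_apply u ∅ MeasurableSet.empty
  rw [measure_empty, eq_comm, ENNReal.ofReal_eq_zero] at h
  exact norm_eq_zero.1 (pow_eq_zero_iff two_ne_zero |>.1 (le_antisymm h (sq_nonneg _)))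

/-- Finite additivity: the difference of the two sides is annihilated by `P(B)` and `P(Bᶜ)`, so that
its spectral measure vanishes. -/
theorem proj_add_proj_compl {B : Set ℝ≥0} (hB : MeasurableSet B) (u : H) :
    P.proj B u + P.proj Bᶜ u = u := by
  have hz : P.measure (u - (P.proj B u + P.proj Bᶜ u)) Set.univ = 0 := by
    rw [← measure_add_measure_compl hB, P.measure_apply _ _ hB, P.measure_apply _ _ hB.compl]
    simp only [map_sub, map_add, proj_proj hB hB, proj_proj hB hB.compl, proj_proj hB.compl hB,
      proj_proj hB.compl hB.compl, Set.inter_self, Set.inter_compl_self, Set.compl_inter_self,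
      proj_empty]
    simp
  rw [measure_univ, ENNReal.ofReal_eq_zero] at hz
  have h := norm_eq_zero.1 (pow_eq_zero_iff two_ne_zero |>.1 (le_antisymm hz (sq_nonneg _)))
  exact (sub_eq_zero.1 h).symm

theorem measure_add_of_proj {B : Set ℝ≥0} (hB : MeasurableSet B) {u v : H} (hu : P.proj B u = u)
    (hv : P.proj Bᶜ v = v) : P.measure (u + v) = P.measure u + P.measure v := by
  have h1 : P.proj B v = 0 := by
    rw [← hv, proj_proj hB hB.compl, Set.inter_compl_self, proj_empty]
  have h2 : P.proj Bᶜ u = 0 := by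
    rw [← hu, proj_proj hB.compl hB, Set.compl_inter_self, proj_empty]
  have h3 := P.measure_proj hB (u + v)
  have h4 := P.measure_proj hB.compl (u + v)
  rw [map_add, h1, hu, add_zero] at h3
  rw [map_add, h2, hv, zero_add] at h4
  rw [h3, h4, Measure.restrict_add_restrict_compl hB]

/-- The cut-offs `P([0, n]) u` converge to `u`. -/
theorem tendsto_proj_Iic (u : H) :
    Tendsto (fun n : ℕ => P.proj (Set.Iic (n : ℝ≥0)) u) atTop (𝓝 u) := by
  have h1 : ∀ n : ℕ, ‖P.proj (Set.Iic (n : ℝ≥0)) u - u‖ ^ 2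
      = ((P.measure u) (Set.Ioi (n : ℝ≥0))).toReal := fun n => by
    have h := proj_add_proj_compl (P := P) (measurableSet_Iic (a := (n : ℝ≥0))) u
    rw [Set.compl_Iic] at h
    have h' : P.proj (Set.Iic (n : ℝ≥0)) u - u = - P.proj (Set.Ioi (n : ℝ≥0)) u := by
      conv_lhs => rw [← h]
      rw [map_add, proj_proj measurableSet_Iic measurableSet_Iic,
        proj_proj measurableSet_Iic measurableSet_Ioi, Set.inter_self, Set.Iic_inter_Ioi,
        Set.Ioc_self, proj_empty]
      abel
    rw [h', norm_neg, P.measure_apply _ _ measurableSet_Ioi, ENNReal.toReal_ofReal (sq_nonneg _)]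
  have h2 : Tendsto (fun n : ℕ => (P.measure u) (Set.Ioi (n : ℝ≥0))) atTop (𝓝 0) := by
    have h := tendsto_measure_iInter_atTop (μ := P.measure u)
      (s := fun n : ℕ => Set.Ioi (n : ℝ≥0)) (fun n => measurableSet_Ioi.nullMeasurableSet)
      (fun m n hmn => Set.Ioi_subset_Ioi (by exact_mod_cast hmn)) ⟨0, measure_ne_top _ _⟩
    have h0 : (⋂ n : ℕ, Set.Ioi (n : ℝ≥0)) = ∅ := by
      refine Set.eq_empty_of_forall_notMem fun t ht => ?_
      obtain ⟨n, hn⟩ := exists_nat_ge t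
      exact absurd (Set.mem_iInter.1 ht n) (not_lt.2 hn)
    rwa [h0, measure_empty] at h
  rw [tendsto_iff_norm_sub_tendsto_zero]
  have h3 := ((ENNReal.tendsto_toReal ENNReal.zero_ne_top).comp h2).sqrt
  simpa [Function.comp_def, ← h1] using h3

theorem moment_proj_le {B : Set ℝ≥0} (hB : MeasurableSet B) (k : ℕ) (u : H) :
    P.moment k (P.proj B u) ≤ P.moment k u := by
  rw [ProjectionValuedMeasure.moment, measure_proj hB]
  exact lintegral_mono' Measure.restrict_le_self le_rfl

/-- Monotone convergence along the cut-offs `P([0, n]) u`. -/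
theorem moment_le_of_forall_proj_Iic {k : ℕ} {u : H} {M : ℝ≥0∞}
    (h : ∀ n : ℕ, P.moment k (P.proj (Set.Iic (n : ℝ≥0)) u) ≤ M) : P.moment k u ≤ M := by
  have hU : (⋃ n : ℕ, Set.Iic (n : ℝ≥0)) = Set.univ :=
    Set.eq_univ_of_forall fun t => Set.mem_iUnion.2 (exists_nat_ge t)
  have hd : Directed (· ⊆ ·) fun n : ℕ => Set.Iic (n : ℝ≥0) :=
    Monotone.directed_le fun m n hmn => Set.Iic_subset_Iic.2 (by exact_mod_cast hmn)
  rw [ProjectionValuedMeasure.moment, ← setLIntegral_univ, ← hU,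
    setLIntegral_iUnion_of_directed _ hd]
  refine iSup_le fun n => ?_
  have h' := h n
  rwa [ProjectionValuedMeasure.moment, measure_proj measurableSet_Iic] at h'

namespace IsSpectralResolution

variable (hP : P.IsSpectralResolution L)
include hP

theorem proj_mem_domain {B : Set ℝ≥0} (hB : MeasurableSet B) {u : H} (hu : u ∈ L.domain) :
    P.proj B u ∈ L.domain := by
  rw [hP.mem_domain_iff] at hu ⊢
  rw [measure_proj hB]
  exact (lintegral_mono' Measure.restrict_le_self le_rfl).trans_lt hu

theorem proj_mem_domain_of_subset_Iic {B : Set ℝ≥0} (hB : MeasurableSet B) {r : ℝ≥0}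
    (hr : B ⊆ Set.Iic r) (u : H) : P.proj B u ∈ L.domain := by
  rw [hP.mem_domain_iff, measure_proj hB]
  calc ∫⁻ t in B, (t : ℝ≥0∞) ^ 2 ∂(P.measure u)
      ≤ ∫⁻ _ in B, (r : ℝ≥0∞) ^ 2 ∂(P.measure u) :=
        setLIntegral_mono' hB fun t ht => by gcongr; exact hr ht
    _ < ∞ := by
        rw [setLIntegral_const]
        exact ENNReal.mul_lt_top (by simp) (measure_lt_top _ _)

/-- The domain of `L` is dense, since it contains the cut-offs `P([0, n]) w`. -/
theorem eq_zero_of_forall_inner {w : H} (hw : ∀ v ∈ L.domain, ⟪v, w⟫_ℂ = 0) : w = 0 := by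
  refine (inner_self_eq_zero (𝕜 := ℂ)).1 (tendsto_nhds_unique
    ((tendsto_proj_Iic (P := P) w).inner (tendsto_const_nhds (x := w))) ?_)
  refine tendsto_const_nhds.congr fun n => ?_
  exact (hw _ (hP.proj_mem_domain_of_subset_Iic measurableSet_Iic subset_rfl w)).symm

theorem integrable {u : H} (hu : u ∈ L.domain) :
    Integrable (fun t : ℝ≥0 => (t : ℝ)) (P.measure u) := by
  have h : MemLp (fun t : ℝ≥0 => (t : ℝ)) 2 (P.measure u) := by
    refine (memLp_two_iff_integrable_sq (by fun_prop)).2 ⟨by fun_prop, ?_⟩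
    rw [hasFiniteIntegral_iff_ofReal (ae_of_all _ fun t => sq_nonneg _)]
    refine lt_of_eq_of_lt (lintegral_congr fun t => ?_) ((hP.mem_domain_iff u).1 hu)
    rw [ENNReal.ofReal_pow (NNReal.coe_nonneg _), ENNReal.ofReal_coe_nnreal]
  exact h.integrable (by norm_num)

/-- Spectral subspaces of complementary sets are orthogonal with respect to `⟪v, L u⟫`. -/
theorem inner_apply_eq_zero {B : Set ℝ≥0} (hB : MeasurableSet B) (u v : L.domain)
    (hu : P.proj B u = u) (hv : P.proj Bᶜ v = v) : ⟪(v : H), L u⟫_ℂ = 0 := by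
  -- the cross terms of the quadratic form vanish for `u + v` and for `i u + v`
  have key : ∀ u : L.domain, P.proj B u = u → ⟪(u : H), L v⟫_ℂ + ⟪(v : H), L u⟫_ℂ = 0 := by
    intro u hu
    have h := hP.inner_eq (u + v)
    rw [Submodule.coe_add, measure_add_of_proj hB hu hv, integral_add_measure (hP.integrable u.2)
      (hP.integrable v.2), Complex.ofReal_add, ← hP.inner_eq, ← hP.inner_eq, LinearPMap.map_add,
      inner_add_left, inner_add_right, inner_add_right] at h
    linear_combination h
  have h1 := key u hu
  have h2 := key (Complex.I • u) (by rw [Submodule.coe_smul, map_smul, hu])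
  rw [LinearPMap.map_smul, Submodule.coe_smul, inner_smul_left, inner_smul_right,
    Complex.conj_I] at h2
  have h3 : Complex.I * (2 * ⟪(v : H), L u⟫_ℂ) = 0 := by linear_combination h2 + Complex.I * h1
  simpa using h3

/-- `L` maps spectral subspaces to themselves. -/
theorem proj_apply_of_proj_eq {B : Set ℝ≥0} (hB : MeasurableSet B) (u : L.domain)
    (hu : P.proj B u = u) : P.proj B (L u) = L u := by
  have h : P.proj Bᶜ (L u) = 0 := hP.eq_zero_of_forall_inner fun v hv => by
    rw [← inner_proj_left hB.compl]
    refine hP.inner_apply_eq_zero hB u ⟨_, hP.proj_mem_domain hB.compl hv⟩ hu ?_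
    rw [proj_proj hB.compl hB.compl, Set.inter_self]
  have h' := proj_add_proj_compl (P := P) hB (L u)
  rwa [h, add_zero] at h'

/-- The spectral projections commute with the operator. -/
theorem proj_apply {B : Set ℝ≥0} (hB : MeasurableSet B) (u : L.domain) :
    P.proj B (L u) = L ⟨P.proj B u, hP.proj_mem_domain hB u.2⟩ := by
  have h1 := hP.proj_apply_of_proj_eq hB ⟨P.proj B u, hP.proj_mem_domain hB u.2⟩
    (by rw [proj_proj hB hB, Set.inter_self])
  have h2 := hP.proj_apply_of_proj_eq hB.compl ⟨P.proj Bᶜ u, hP.proj_mem_domain hB.compl u.2⟩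
    (by rw [proj_proj hB.compl hB.compl, Set.inter_self])
  have hu : u = (⟨P.proj B u, hP.proj_mem_domain hB u.2⟩ : L.domain)
      + ⟨P.proj Bᶜ u, hP.proj_mem_domain hB.compl u.2⟩ :=
    Subtype.ext (proj_add_proj_compl hB (u : H)).symm
  conv_lhs => rw [hu, LinearPMap.map_add, map_add, h1, ← h2, proj_proj hB hB.compl,
    Set.inter_compl_self, proj_empty, add_zero]

theorem le_norm_apply {B : Set ℝ≥0} (hB : MeasurableSet B) {a : ℝ≥0} (ha : B ⊆ Set.Ici a)
    (u : L.domain) (hu : P.proj B u = u) : a * ‖(u : H)‖ ≤ ‖L u‖ := by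
  have h1 : a * ‖(u : H)‖ ^ 2 ≤ ∫ t, (t : ℝ) ∂(P.measure (u : H)) := by
    have hm := P.measure_proj hB (u : H)
    rw [hu] at hm
    have hi := hP.integrable u.2
    have h2 : ∫ _, (a : ℝ) ∂(P.measure (u : H)) = a * ‖(u : H)‖ ^ 2 := by
      rw [integral_const, Measure.real, measure_univ, ENNReal.toReal_ofReal (sq_nonneg _),
        smul_eq_mul, mul_comm]
    rw [← h2]
    refine integral_mono_ae (integrable_const _) hi ?_
    rw [hm]
    filter_upwards [ae_restrict_mem hB] with t ht
    exact_mod_cast ha ht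
  have h2 : (⟪(u : H), L u⟫_ℂ).re = ∫ t, (t : ℝ) ∂(P.measure (u : H)) := by
    rw [hP.inner_eq, Complex.ofReal_re]
  have h3 : (⟪(u : H), L u⟫_ℂ).re ≤ ‖(u : H)‖ * ‖L u‖ :=
    re_inner_le_norm (𝕜 := ℂ) _ _
  rcases (norm_nonneg (u : H)).eq_or_lt with h0 | h0
  · rw [← h0, mul_zero]; exact norm_nonneg _
  · refine le_of_mul_le_mul_left ?_ h0
    nlinarith

/-- On the spectral subspace of `B ⊆ [0, r]` the operator is everywhere defined and symmetric, hence
bounded, and it satisfies `0 ≤ ⟪u, L u⟫ ≤ r ‖u‖²`. -/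
theorem norm_apply_le {B : Set ℝ≥0} (hB : MeasurableSet B) {r : ℝ≥0} (hr : B ⊆ Set.Iic r)
    (u : L.domain) (hu : P.proj B u = u) : ‖L u‖ ≤ r * ‖(u : H)‖ := by
  have hdom := hP.proj_mem_domain_of_subset_Iic hB hr
  let T₀ : H →ₗ[ℂ] H := L.toFun ∘ₗ (P.proj B).toLinearMap.codRestrict L.domain hdom
  have hT₀ : ∀ v, T₀ v = L ⟨P.proj B v, hdom v⟩ := fun v => rfl
  have hinner : ∀ v, ⟪T₀ v, v⟫_ℂ = ((∫ t in B, (t : ℝ) ∂(P.measure v) : ℝ) : ℂ) := by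
    intro v
    have h1 := hP.inner_eq ⟨P.proj B v, hdom v⟩
    rw [inner_proj_left hB, hP.proj_apply_of_proj_eq hB, measure_proj hB] at h1
    · rw [← inner_conj_symm, hT₀, h1, Complex.conj_ofReal]
    · rw [proj_proj hB hB, Set.inter_self]
  have hsym : T₀.IsSymmetric := by
    rw [LinearMap.isSymmetric_iff_inner_map_self_real]
    intro v
    rw [hinner, Complex.conj_ofReal]
  let T : H →L[ℂ] H := ⟨T₀, hsym.continuous⟩
  have hTpos : 0 ≤ T := by
    rw [ContinuousLinearMap.nonneg_iff_isPositive]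
    refine ⟨hsym, fun v => ?_⟩
    rw [ContinuousLinearMap.reApplyInnerSelf_apply]
    change 0 ≤ (⟪T₀ v, v⟫_ℂ).re
    rw [hinner, Complex.ofReal_re]
    exact integral_nonneg fun t => t.2
  have hTle : T ≤ algebraMap ℝ (H →L[ℂ] H) r := by
    rw [ContinuousLinearMap.le_def, ContinuousLinearMap.isPositive_iff_complex]
    intro v
    have h1 : ⟪(algebraMap ℝ (H →L[ℂ] H) r - T) v, v⟫_ℂ
        = ((r * ‖v‖ ^ 2 - ∫ t in B, (t : ℝ) ∂(P.measure v) : ℝ) : ℂ) := by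
      rw [_root_.sub_apply, inner_sub_left]
      change _ - ⟪T₀ v, v⟫_ℂ = _
      rw [hinner, Algebra.algebraMap_eq_smul_one]
      simp [inner_smul_left_eq_smul, inner_self_eq_norm_sq_to_K]
    rw [h1]
    refine ⟨rfl, ?_⟩
    have h2 : ∫ t in B, (t : ℝ) ∂(P.measure v) ≤ r * ‖v‖ ^ 2 := by
      have h3 : ∫ _, (r : ℝ) ∂(P.measure v) = r * ‖v‖ ^ 2 := by
        rw [integral_const, Measure.real, measure_univ, ENNReal.toReal_ofReal (sq_nonneg _),
          smul_eq_mul, mul_comm]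
      rw [← h3]
      refine le_trans (integral_mono_of_nonneg (ae_of_all _ fun t => t.2)
        (integrable_const (r : ℝ)) ?_) (setIntegral_le_integral (integrable_const _)
        (ae_of_all _ fun _ => r.2))
      filter_upwards [ae_restrict_mem hB] with t ht
      exact_mod_cast hr ht
    rw [RCLike.re_eq_complex_re, Complex.ofReal_re]
    exact sub_nonneg.2 h2
  have hT : ‖T‖ ≤ r := (CStarAlgebra.norm_le_iff_le_algebraMap T r.2 hTpos).2 hTle
  have h := T.le_of_opNorm_le hT u
  have hTu : T u = L u := by
    change L ⟨P.proj B u, hdom u⟩ = L u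
    congr 1
    exact Subtype.ext hu
  rwa [hTu] at h

/-- The second moment of a spectral resolution is `‖L u‖²`. -/
theorem moment_two (u : L.domain) : P.moment 2 (u : H) = ENNReal.ofReal (‖L u‖ ^ 2) := by
  rw [← measure_univ (P := P), ProjectionValuedMeasure.moment]
  refine lintegral_sq_eq_measure_univ ?_ fun a b B hB hBab => ?_
  · have h2 := (hP.mem_domain_iff u).1 u.2
    refine ne_of_lt ?_
    calc ∫⁻ t, ((t + 1 : ℝ≥0) : ℝ≥0∞) ^ 2 ∂(P.measure (u : H))
        ≤ ∫⁻ t, 2 * ((t : ℝ≥0∞) ^ 2 + 1) ∂(P.measure (u : H)) := lintegral_mono fun t => by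
          have ht : (t + 1) ^ 2 ≤ 2 * (t ^ 2 + 1) := by
            rw [← NNReal.coe_le_coe]
            push_cast
            nlinarith [sq_nonneg ((t : ℝ) - 1)]
          have ht' := ENNReal.coe_le_coe.2 ht
          push_cast at ht' ⊢
          exact ht'
      _ < ∞ := by
          rw [lintegral_const_mul' _ _ (by simp), lintegral_add_right _ measurable_const,
            lintegral_const, one_mul]
          exact ENNReal.mul_lt_top (by simp) (ENNReal.add_lt_top.2 ⟨h2, measure_lt_top _ _⟩)
  · have hdom := hP.proj_mem_domain hB u.2
    have hpp : P.proj B (P.proj B (u : H)) = P.proj B (u : H) := by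
      rw [proj_proj hB hB, Set.inter_self]
    have h1 := hP.le_norm_apply hB (fun t ht => (hBab ht).1) ⟨_, hdom⟩ hpp
    have h2 := hP.norm_apply_le hB (fun t ht => (hBab ht).2) ⟨_, hdom⟩ hpp
    rw [P.measure_apply _ _ hB, P.measure_apply _ _ hB, hP.proj_apply hB,
      ← ENNReal.ofReal_coe_nnreal, ← ENNReal.ofReal_coe_nnreal,
      ← ENNReal.ofReal_pow a.coe_nonneg, ← ENNReal.ofReal_pow b.coe_nonneg,
      ← ENNReal.ofReal_mul (sq_nonneg _), ← ENNReal.ofReal_mul (sq_nonneg _), ← mul_pow, ← mul_pow]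
    exact ⟨ENNReal.ofReal_le_ofReal (pow_le_pow_left₀ (by positivity) h1 2),
      ENNReal.ofReal_le_ofReal (pow_le_pow_left₀ (norm_nonneg _) h2 2)⟩

theorem moment_one (u : L.domain) : P.moment 1 (u : H) = ENNReal.ofReal (⟪(u : H), L u⟫_ℂ).re := by
  rw [hP.inner_eq, Complex.ofReal_re, ofReal_integral_eq_lintegral_ofReal (hP.integrable u.2)
    (ae_of_all _ fun t => t.2), ProjectionValuedMeasure.moment]
  simp

end IsSpectralResolution

end ProjectionValuedMeasure

end SpectralCalculus

noncomputable section NetworkLaplacian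

namespace Network

variable {G : Type*} (N : Network G) (o : G)

/-! ### The Laplacian on the energy space -/

theorem continuous_lapE_apply (x : G) : Continuous fun u : N.EnergySpace => N.lapE u x := by
  simp only [← inner_dirac]
  fun_prop

theorem eq_zero_of_evalDiff {u : N.EnergySpace} (h : ∀ x, N.evalDiff x o u = 0) : u = 0 := by
  obtain ⟨f, rfl⟩ := N.mk_surjective u
  refine (Submodule.Quotient.mk_eq_zero N.constants).2 ((N.mem_constants f).2
    ⟨(f : G → ℂ) o, fun x => sub_eq_zero.1 ?_⟩)
  rw [← evalDiff_mk]; exact h x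

/-- A function with the differences of an element `w` of the energy space represents `w`. -/
theorem exists_toEnergy_eq {g : G → ℂ} {w : N.EnergySpace}
    (h : ∀ x, g x - g o = N.evalDiff x o w) :
    ∃ hg : g ∈ N.energyDomain, N.toEnergy ⟨g, hg⟩ = w := by
  obtain ⟨f, rfl⟩ := N.mk_surjective w
  have hd : ∀ x y, g x - g y = (f : G → ℂ) x - (f : G → ℂ) y := fun x y => by
    have hx := h x
    have hy := h y
    rw [evalDiff_mk] at hx hy
    linear_combination hx - hy
  have hg : g ∈ N.energyDomain := by
    have hf : N.FiniteEnergy f := f.2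
    change N.FiniteEnergy g
    simpa only [FiniteEnergy, hd] using hf
  refine ⟨hg, sub_eq_zero.1 (N.eq_zero_of_evalDiff o fun x => ?_)⟩
  rw [map_sub, evalDiff_mk, evalDiff_mk]
  exact sub_eq_zero.2 (hd x o)

/-- The maximum principle: a square summable function attains its maximal modulus, and there
`g + Δ g = 0` forces it to vanish. -/
theorem eq_zero_of_add_lap_eq_zero {g : G → ℂ} (hg : Memℓp g 2) (h : ∀ x, g x + N.lap g x = 0) :
    g = 0 := by
  by_contra hne
  obtain ⟨x₀, hx₀⟩ := Function.ne_iff.1 hne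
  have hpos : 0 < ‖g x₀‖ ^ 2 := by
    have := norm_pos_iff.2 hx₀
    positivity
  have hsum : Summable fun x => ‖g x‖ ^ 2 := by
    simpa using hg.summable (by norm_num)
  have hfin : {x | ¬ ‖g x‖ ^ 2 < ‖g x₀‖ ^ 2}.Finite :=
    hsum.tendsto_cofinite_zero.eventually (gt_mem_nhds hpos)
  obtain ⟨x, hx, hmax⟩ := Set.exists_max_image _ (fun x => ‖g x‖ ^ 2) hfin ⟨x₀, lt_irrefl _⟩
  have hle : ∀ y, ‖g y‖ ≤ ‖g x‖ := fun y => by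
    refine (sq_le_sq₀ (norm_nonneg _) (norm_nonneg _)).1 ?_
    by_cases hy : ‖g y‖ ^ 2 < ‖g x₀‖ ^ 2
    · exact hy.le.trans (not_lt.1 hx)
    · exact hmax y hy
  have hS : 0 ≤ ∑ y ∈ N.nbrs x, N.cond x y := Finset.sum_nonneg fun y _ => N.nonneg x y
  have h1 : (1 + ∑ y ∈ N.nbrs x, (N.cond x y : ℂ)) * g x
      = ∑ y ∈ N.nbrs x, (N.cond x y : ℂ) * g y := by
    have hx := h x
    change g x + ∑ y ∈ N.nbrs x, (N.cond x y : ℂ) * (g x - g y) = 0 at hx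
    simp only [mul_sub, Finset.sum_sub_distrib] at hx
    rw [add_mul, one_mul, Finset.sum_mul]
    linear_combination hx
  have h2 : (1 + ∑ y ∈ N.nbrs x, N.cond x y) * ‖g x‖ ≤ (∑ y ∈ N.nbrs x, N.cond x y) * ‖g x‖ := by
    calc (1 + ∑ y ∈ N.nbrs x, N.cond x y) * ‖g x‖
        = ‖(1 + ∑ y ∈ N.nbrs x, (N.cond x y : ℂ)) * g x‖ := by
          rw [norm_mul, ← Complex.ofReal_sum, ← Complex.ofReal_one, ← Complex.ofReal_add,
            Complex.norm_real, Real.norm_of_nonneg (by positivity)]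
      _ ≤ ∑ y ∈ N.nbrs x, ‖(N.cond x y : ℂ) * g y‖ := by rw [h1]; exact norm_sum_le _ _
      _ ≤ ∑ y ∈ N.nbrs x, N.cond x y * ‖g x‖ := Finset.sum_le_sum fun y _ => by
          rw [norm_mul, Complex.norm_real, Real.norm_of_nonneg (N.nonneg x y)]
          exact mul_le_mul_of_nonneg_left (hle y) (N.nonneg x y)
      _ = _ := (Finset.sum_mul _ _ _).symm
  have h3 : ‖g x₀‖ ≤ 0 := (hle x₀).trans (by linarith)
  exact hx₀ (norm_le_zero_iff.1 h3)

/-- Injectivity of `1 + Δ` on the elements of the energy space with square summable Laplacian. If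
`u + Δ u` is constant, then `g = Δ u` satisfies `g + Δ g = 0`. -/
theorem eq_zero_of_add_lapE_const {u : N.EnergySpace} (hu : Memℓp (N.lapE u) 2)
    (h : ∀ x, N.evalDiff x o u + (N.lapE u x - N.lapE u o) = 0) : u = 0 := by
  have hz : N.lapE u = 0 := by
    refine N.eq_zero_of_add_lap_eq_zero hu fun x => ?_
    obtain ⟨f, rfl⟩ := N.mk_surjective u
    simp only [evalDiff_mk, lapE_mk] at h ⊢
    change N.lap f x + ∑ y ∈ N.nbrs x, (N.cond x y : ℂ) * (N.lap f x - N.lap f y) = 0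
    have h1 : ∀ y, N.lap f x - N.lap f y = - ((f : G → ℂ) x - (f : G → ℂ) y) := fun y => by
      linear_combination h x - h y
    simp only [h1, mul_neg, Finset.sum_neg_distrib]
    exact add_neg_cancel (N.lap f x)
  refine N.eq_zero_of_evalDiff o fun x => ?_
  simpa [hz] using h x

/-! ### The graph of the closure of the Laplacian into `ℓ²` -/

/-- The graph `{(u, Δ u)}` of the pointwise Laplacian in the Hilbert sum of the energy space and
`ℓ²(G)`. -/
def lapGraph : Submodule ℂ (WithLp 2 (N.EnergySpace × lp (fun _ : G => ℂ) 2)) where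
  carrier := {p | ∀ x, N.lapE p.fst x = p.snd x}
  zero_mem' x := by simp
  add_mem' {p q} hp hq x := by
    simp [hp x, hq x]
  smul_mem' a p hp x := by
    simp [hp x]

theorem isClosed_lapGraph :
    IsClosed (N.lapGraph : Set (WithLp 2 (N.EnergySpace × lp (fun _ : G => ℂ) 2))) := by
  have h : (N.lapGraph : Set (WithLp 2 (N.EnergySpace × lp (fun _ : G => ℂ) 2)))
      = ⋂ x, {p | N.lapE p.fst x = p.snd x} := by
    ext p; simp only [Set.mem_iInter]; rfl
  rw [h]
  refine isClosed_iInter fun x => isClosed_eq ?_ ?_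
  · exact (N.continuous_lapE_apply x).comp (WithLp.continuous_fst 2 _ _)
  · exact (lp.lipschitzWith_one_eval (E := fun _ : G => ℂ) 2 x).continuous.comp
      (WithLp.continuous_snd 2 _ _)

instance : CompleteSpace N.lapGraph := N.isClosed_lapGraph.completeSpace_coe

theorem lapGraph_snd (p : N.lapGraph) (x : G) : p.1.snd x = N.lapE p.1.fst x :=
  (p.2 x).symm

theorem memlp_lapE_fst (p : N.lapGraph) : Memℓp (N.lapE p.1.fst) 2 := by
  have h : N.lapE p.1.fst = p.1.snd := funext p.2
  rw [h]; exact lp.memℓp _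

/-- The element `(u, Δ u)` of the graph. -/
def graphMk (u : N.EnergySpace) (hu : Memℓp (N.lapE u) 2) : N.lapGraph :=
  ⟨WithLp.toLp 2 (u, ⟨N.lapE u, hu⟩), fun _ => rfl⟩

theorem memlp_lapE_kernelSpan {u : N.EnergySpace} (hu : u ∈ N.kernelSpan o) :
    Memℓp (N.lapE u) 2 := by
  refine memℓp_gen (summable_of_ne_finset_zero (s := (N.inner_kernelSpan o u hu).1.toFinset)
    fun x hx => ?_)
  have : N.lapE u x = 0 := by simpa using hx
  simp [this]

/-- The embedding `u ↦ (u, Δ u)` of the span of the energy kernel into the graph. -/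
def kernelGraph : N.kernelSpan o →ₗ[ℂ] N.lapGraph where
  toFun u := N.graphMk u (N.memlp_lapE_kernelSpan o u.2)
  map_add' u v := Subtype.ext ((WithLp.ofLp_injective 2) (Prod.ext rfl
    (Subtype.ext (map_add N.lapE (u : N.EnergySpace) v))))
  map_smul' a u := Subtype.ext ((WithLp.ofLp_injective 2) (Prod.ext rfl
    (Subtype.ext (map_smul N.lapE a (u : N.EnergySpace)))))

theorem kernel_mem (x : G) : N.kernel o x ∈ N.kernelSpan o := Submodule.subset_span ⟨x, rfl⟩

/-- `⟪(v_x, Δ v_x), (u, Δ u)⟫ = (u + Δ u)(x) - (u + Δ u)(o)`, since `Δ v_x = δ_x - δ_o`. -/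
theorem inner_kernelGraph (x : G) (p : N.lapGraph) :
    ⟪N.kernelGraph o ⟨N.kernel o x, N.kernel_mem o x⟩, p⟫_ℂ
      = N.evalDiff x o p.1.fst
        + (N.lapE p.1.fst x - N.lapE p.1.fst o) := by
  classical
  have h : (⟨N.lapE (N.kernel o x), N.memlp_lapE_kernelSpan o (N.kernel_mem o x)⟩ :
      lp (fun _ : G => ℂ) 2) = lp.single 2 x 1 - lp.single 2 o 1 := by
    ext y
    change N.lapE (N.kernel o x) y = _
    rw [lapE_kernel]
    simp [dirac_apply, lp.single_apply, Pi.single_apply]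
  rw [Submodule.coe_inner, WithLp.prod_inner_apply]
  change ⟪N.kernel o x, _⟫_ℂ + ⟪(⟨N.lapE (N.kernel o x), _⟩ : lp (fun _ : G => ℂ) 2), _⟫_ℂ = _
  rw [inner_kernel, h, inner_sub_left, lp.inner_single_left, lp.inner_single_left]
  simp only [RCLike.inner_apply, map_one, mul_one]
  congr 1
  exact congrArg₂ _ (p.2 x).symm (p.2 o).symm

/-- The span of the energy kernel is a core: this is where the maximum principle enters. -/
theorem denseRange_kernelGraph : DenseRange (N.kernelGraph o) := by
  change Dense (Set.range (N.kernelGraph o))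
  rw [← LinearMap.coe_range, Submodule.dense_iff_topologicalClosure_eq_top,
    Submodule.topologicalClosure_eq_top_iff, Submodule.eq_bot_iff]
  intro p hp
  rw [Submodule.mem_orthogonal] at hp
  have h0 : p.1.fst = 0 := by
    refine N.eq_zero_of_add_lapE_const o (N.memlp_lapE_fst p) fun x => ?_
    rw [← inner_kernelGraph]
    exact hp _ ⟨_, rfl⟩
  refine Subtype.ext ((WithLp.ofLp_injective 2) (Prod.ext h0 ?_))
  ext x
  have h := N.lapGraph_snd p x
  rw [h0, map_zero] at h
  exact h

/-! ### The Friedrichs extension of the network Laplacian -/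

/-- The quadratic form of the Laplacian is `‖Δ u‖²` in `ℓ²`. -/
theorem quadForm_laplacian (u : N.kernelSpan o) :
    (N.laplacian o).quadForm u = ‖(N.kernelGraph o u).1.snd‖ ^ 2 := by
  obtain ⟨hfin, h⟩ := N.inner_kernelSpan o u u.2
  have hs : Function.support (fun x => conj (N.lapE u x) * N.lapE u x) ⊆ hfin.toFinset := by
    intro x hx
    simp only [Set.Finite.coe_toFinset]
    exact fun h => hx (by simp [h])
  refine (congrArg Complex.re (h ⟨N.lapE u, N.lapE_mem o u⟩)).trans ?_
  rw [@norm_sq_eq_re_inner ℂ, lp.inner_eq_tsum,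
    finsum_eq_sum_of_support_subset _ hs, tsum_eq_sum (s := hfin.toFinset)]
  · simp only [RCLike.inner_apply, lapGraph_snd]
    simp only [mul_comm]
    rfl
  · intro x hx
    have h0 : N.lapE u x = 0 := by simpa using hx
    simp only [lapGraph_snd, RCLike.inner_apply]
    change N.lapE u x * _ = 0
    rw [h0, zero_mul]

/-- The form domain of the Laplacian consists of the `u` with `Δ u ∈ ℓ²`. -/
theorem mem_formDomain_iff (u : N.EnergySpace) :
    u ∈ formDomain (N.laplacian o) (N.laplacian_nonneg o) ↔ Memℓp (N.lapE u) 2 := by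
  have hdist : ∀ v w : N.kernelSpan o, (N.laplacian o).quadForm (v - w)
      = dist (N.kernelGraph o v).1.snd (N.kernelGraph o w).1.snd ^ 2 :=
    fun v w => by rw [quadForm_laplacian, map_sub, dist_eq_norm]; rfl
  constructor
  · rintro ⟨s, hs, hs'⟩
    have hc : CauchySeq fun n => (N.kernelGraph o (s n)).1.snd := by
      rw [cauchySeq_iff_tendsto_dist_atTop_0]
      have h := (hs'.congr fun p => hdist _ _).sqrt
      simpa only [Real.sqrt_sq dist_nonneg, Real.sqrt_zero] using h
    obtain ⟨g, hg⟩ := cauchySeq_tendsto_of_complete hc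
    have h : N.lapE u = g := by
      funext x
      refine tendsto_nhds_unique (((N.continuous_lapE_apply x).tendsto u).comp hs) ?_
      exact ((lp.lipschitzWith_one_eval (E := fun _ : G => ℂ) 2 x).continuous.tendsto g).comp hg
    rw [h]; exact lp.memℓp g
  · intro hu
    obtain ⟨t, ht, ht'⟩ :=
      mem_closure_iff_seq_limit.1 (N.denseRange_kernelGraph o (N.graphMk u hu))
    choose s hs using ht
    have ht'' := (continuous_subtype_val.tendsto _).comp ht'
    refine ⟨s, ?_, ?_⟩
    · have h := ((WithLp.continuous_fst 2 _ _).tendsto _).comp ht''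
      refine h.congr fun n => ?_
      simp only [Function.comp, ← hs n]; rfl
    · have h := ((WithLp.continuous_snd 2 _ _).tendsto _).comp ht''
      have hc := cauchySeq_iff_tendsto_dist_atTop_0.1 h.cauchySeq
      have h2 := hc.pow 2
      rw [zero_pow two_ne_zero] at h2
      refine h2.congr fun n => ?_
      simp only [Function.comp, ← hs]
      exact (hdist _ _).symm

theorem dense_kernelSpan : Dense ((N.laplacian o).domain : Set N.EnergySpace) := by
  change Dense (N.kernelSpan o : Set N.EnergySpace)
  rw [Submodule.dense_iff_topologicalClosure_eq_top,
    Submodule.topologicalClosure_eq_top_iff, Submodule.eq_bot_iff]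
  intro u hu
  rw [Submodule.mem_orthogonal] at hu
  refine N.eq_zero_of_evalDiff o fun x => ?_
  rw [← inner_kernel]
  exact hu _ (N.kernel_mem o x)

theorem inner_laplacian_kernel (u : N.EnergySpace) (x : G) :
    ⟪N.laplacian o ⟨N.kernel o x, N.kernel_mem o x⟩, u⟫_ℂ = N.lapE u x - N.lapE u o := by
  have h : N.laplacian o ⟨N.kernel o x, N.kernel_mem o x⟩
      = N.toEnergy (N.dirac x) - N.toEnergy (N.dirac o) := by
    rw [laplacian_apply, ← map_sub]
    congr 1
    exact Subtype.ext (N.lapE_kernel o x)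
  rw [h, inner_sub_left, inner_dirac, inner_dirac]

/-- The adjoint of the Laplacian is the pointwise Laplacian on the `u` for which `Δ u` has finite
energy. -/
theorem adjoint_laplacian_apply (u : (N.laplacian o).adjoint.domain) :
    ∃ h : N.lapE u ∈ N.energyDomain, (N.laplacian o).adjoint u = N.toEnergy ⟨N.lapE u, h⟩ := by
  obtain ⟨h, h'⟩ := N.exists_toEnergy_eq o (g := N.lapE u) (w := (N.laplacian o).adjoint u)
    fun x => by
      have h := (N.laplacian o).adjoint_isFormalAdjoint (N.dense_kernelSpan o) u
        ⟨N.kernel o x, N.kernel_mem o x⟩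
      rw [← inner_kernel, ← inner_laplacian_kernel, ← inner_conj_symm, ← h, inner_conj_symm]
  exact ⟨h, h'.symm⟩

theorem mem_adjoint_laplacian_domain {u : N.EnergySpace} (h : N.lapE u ∈ N.energyDomain) :
    u ∈ (N.laplacian o).adjoint.domain := by
  have key : ∀ v (hv : v ∈ N.kernelSpan o),
      ⟪v, N.toEnergy ⟨N.lapE u, h⟩⟫_ℂ = ⟪N.laplacian o ⟨v, hv⟩, u⟫_ℂ := by
    intro v hv
    induction hv using Submodule.span_induction with
    | mem v hv =>
      obtain ⟨x, rfl⟩ := hv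
      rw [inner_laplacian_kernel, inner_kernel, evalDiff_mk]
    | zero =>
      rw [inner_zero_left]
      exact (inner_zero_left _).symm.trans (congrArg (⟪·, u⟫_ℂ) (N.laplacian o).map_zero.symm)
    | add v w hv hw ihv ihw =>
      have h := (N.laplacian o).map_add ⟨v, hv⟩ ⟨w, hw⟩
      rw [inner_add_left, ihv, ihw, ← inner_add_left, ← h]
      rfl
    | smul a v hv ih =>
      have h := (N.laplacian o).map_smul a ⟨v, hv⟩
      rw [inner_smul_left, ih, ← inner_smul_left, ← h]
      rfl
  refine (N.laplacian o).mem_adjoint_domain_of_exists u ⟨N.toEnergy ⟨N.lapE u, h⟩, fun v => ?_⟩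
  rw [← inner_conj_symm, key v v.2, inner_conj_symm]

/-- The domain of the Friedrichs extension consists of the `u` for which `Δ u` lies in `ℓ²` and has
finite energy. -/
theorem mem_friedrichs_domain_iff (u : N.EnergySpace) :
    u ∈ (N.friedrichsLaplacian o).domain ↔ Memℓp (N.lapE u) 2 ∧ N.lapE u ∈ N.energyDomain := by
  change u ∈ formDomain (N.laplacian o) (N.laplacian_nonneg o) ∧ u ∈ (N.laplacian o).adjoint.domain
    ↔ _
  rw [mem_formDomain_iff]
  exact and_congr_right fun _ => ⟨fun h => (N.adjoint_laplacian_apply o ⟨u, h⟩).1,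
    N.mem_adjoint_laplacian_domain o⟩

/-- On its domain, the Friedrichs extension is the pointwise Laplacian. -/
theorem friedrichsLaplacian_apply (u : (N.friedrichsLaplacian o).domain)
    (h : N.lapE u ∈ N.energyDomain) :
    N.friedrichsLaplacian o u = N.toEnergy ⟨N.lapE u, h⟩ :=
  (N.adjoint_laplacian_apply o ⟨u, u.2.2⟩).2

theorem evalDiff_friedrichsLaplacian (u : (N.friedrichsLaplacian o).domain) (x : G) :
    N.evalDiff x o (N.friedrichsLaplacian o u) = N.lapE u x - N.lapE u o := by
  rw [N.friedrichsLaplacian_apply o u ((N.mem_friedrichs_domain_iff o u).1 u.2).2]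
  rfl

/-! ### The resolvent of the Friedrichs extension -/

/-- The projection `(u, Δ u) ↦ u` of the graph to the energy space. -/
def graphFst : N.lapGraph →L[ℂ] N.EnergySpace := (WithLp.fstL 2 ℂ _ _).comp N.lapGraph.subtypeL

/-- The resolvent `(1 + L)⁻¹ = π π*`, where `π` is the projection of the graph of `Δ` to the energy
space. -/
def resolvent : N.EnergySpace →L[ℂ] N.EnergySpace :=
  N.graphFst ∘L ContinuousLinearMap.adjoint N.graphFst

theorem resolvent_nonneg : 0 ≤ N.resolvent := by
  rw [ContinuousLinearMap.nonneg_iff_isPositive]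
  exact ContinuousLinearMap.isPositive_self_comp_adjoint N.graphFst

theorem norm_resolvent_le : ‖N.resolvent‖ ≤ 1 := by
  have h : ‖N.graphFst‖ ≤ 1 := ContinuousLinearMap.opNorm_le_bound _ zero_le_one fun p => by
    rw [one_mul]; exact WithLp.norm_fst_le _ p.1
  refine (ContinuousLinearMap.opNorm_comp_le _ _).trans ?_
  rw [LinearIsometryEquiv.norm_map]
  exact mul_le_one₀ h (norm_nonneg N.graphFst) h

theorem inner_adjoint_graphFst (p : N.lapGraph) (w : N.EnergySpace) :
    ⟪p, ContinuousLinearMap.adjoint N.graphFst w⟫_ℂ = ⟪p.1.fst, w⟫_ℂ := by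
  rw [ContinuousLinearMap.adjoint_inner_right]; rfl

/-- `R w + Δ (R w) = w` up to constants. -/
theorem evalDiff_resolvent (w : N.EnergySpace) (x : G) :
    N.evalDiff x o (N.resolvent w) + (N.lapE (N.resolvent w) x - N.lapE (N.resolvent w) o)
      = N.evalDiff x o w := by
  rw [← inner_kernel N o x w]
  exact (N.inner_kernelGraph o x (ContinuousLinearMap.adjoint N.graphFst w)).symm.trans
    (N.inner_adjoint_graphFst _ w)

theorem memlp_lapE_resolvent (w : N.EnergySpace) : Memℓp (N.lapE (N.resolvent w)) 2 :=
  N.memlp_lapE_fst (ContinuousLinearMap.adjoint N.graphFst w)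

/-- `L (R w) = w - R w`, so that `R` is a right inverse of `1 + L`. -/
theorem resolvent_mem (w : N.EnergySpace) : ∃ h : N.resolvent w ∈ (N.friedrichsLaplacian o).domain,
    N.friedrichsLaplacian o ⟨N.resolvent w, h⟩ = w - N.resolvent w := by
  obtain ⟨h, h'⟩ := N.exists_toEnergy_eq o (g := N.lapE (N.resolvent w)) (w := w - N.resolvent w)
    fun x => by rw [map_sub, ← evalDiff_resolvent, add_sub_cancel_left]
  exact ⟨(N.mem_friedrichs_domain_iff o _).2 ⟨N.memlp_lapE_resolvent w, h⟩,
    (N.friedrichsLaplacian_apply o ⟨N.resolvent w, _⟩ h).trans h'⟩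

/-- `R` is a left inverse of `1 + L`. -/
theorem resolvent_add_friedrichsLaplacian (u : (N.friedrichsLaplacian o).domain) :
    N.resolvent (u + N.friedrichsLaplacian o u) = u := by
  rw [← sub_eq_zero]
  refine N.eq_zero_of_add_lapE_const o ?_ fun x => ?_
  · rw [map_sub]
    exact (N.memlp_lapE_resolvent _).sub ((N.mem_friedrichs_domain_iff o u).1 u.2).1
  · have h := N.evalDiff_resolvent o (u + N.friedrichsLaplacian o u) x
    rw [map_add (N.evalDiff x o) (u : N.EnergySpace), evalDiff_friedrichsLaplacian] at h
    simp only [map_sub, Pi.sub_apply]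
    linear_combination h

theorem eq_zero_of_resolvent_eq_zero (o : G) (w : N.EnergySpace) (hw : N.resolvent w = 0) :
    w = 0 := by
  refine N.eq_zero_of_evalDiff o fun x => ?_
  rw [← evalDiff_resolvent, hw]
  simp

theorem exists_isSpectralResolution : ∃ P : ProjectionValuedMeasure N.EnergySpace,
    P.IsSpectralResolution (N.friedrichsLaplacian o) :=
  exists_isSpectralResolution_of_resolvent _ N.resolvent N.resolvent_nonneg N.norm_resolvent_le
    (N.eq_zero_of_resolvent_eq_zero o) (N.resolvent_mem o)
    fun u hu => ⟨_, N.resolvent_add_friedrichsLaplacian o ⟨u, hu⟩⟩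

/-! ### The moments of the Friedrichs extension -/

/-- `⟪v, L u⟫ = ⟪Δ v, Δ u⟫` in `ℓ²`, for `v` in the form domain. -/
theorem inner_friedrichsLaplacian {v : N.EnergySpace} (hv : Memℓp (N.lapE v) 2)
    (u : (N.friedrichsLaplacian o).domain) (hu : Memℓp (N.lapE u) 2) :
    ⟪v, N.friedrichsLaplacian o u⟫_ℂ
      = ⟪(⟨N.lapE v, hv⟩ : lp (fun _ : G => ℂ) 2), ⟨N.lapE u, hu⟩⟫_ℂ := by
  have h := N.inner_adjoint_graphFst (N.graphMk v hv) (u + N.friedrichsLaplacian o u)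
  have hp : ContinuousLinearMap.adjoint N.graphFst (u + N.friedrichsLaplacian o u)
      = N.graphMk u hu := by
    have h1 := N.resolvent_add_friedrichsLaplacian o u
    refine Subtype.ext ((WithLp.ofLp_injective 2) (Prod.ext h1 ?_))
    ext x
    refine (N.lapGraph_snd _ x).trans ?_
    exact congrFun (congrArg N.lapE h1) x
  rw [hp, Submodule.coe_inner, WithLp.prod_inner_apply] at h
  change ⟪v, (u : N.EnergySpace)⟫_ℂ + ⟪(⟨N.lapE v, hv⟩ : lp (fun _ : G => ℂ) 2), ⟨N.lapE u, hu⟩⟫_ℂ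
    = ⟪v, _⟫_ℂ at h
  rw [inner_add_right] at h
  exact (add_left_cancel h).symm

theorem tsum_enorm_sq_lp (f : lp (fun _ : G => ℂ) 2) :
    ∑' x, ‖f x‖ₑ ^ 2 = ENNReal.ofReal (‖f‖ ^ 2) := by
  have h := lp.norm_rpow_eq_tsum (p := 2) (by norm_num) f
  have hs := (lp.memℓp f).summable (by norm_num)
  simp only [ENNReal.toReal_ofNat, Real.rpow_ofNat] at h hs
  rw [h, ENNReal.ofReal_tsum_of_nonneg (fun x => sq_nonneg _) hs]
  simp only [ENNReal.ofReal_pow (norm_nonneg _), ofReal_norm]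

theorem memlp_of_tsum_enorm_sq {f : G → ℂ} (h : ∑' x, ‖f x‖ₑ ^ 2 ≠ ∞) : Memℓp f 2 := by
  refine memℓp_gen ?_
  have hs := ENNReal.summable_toReal h
  simpa using hs

variable {N o} {P : ProjectionValuedMeasure N.EnergySpace}
  (hP : P.IsSpectralResolution (N.friedrichsLaplacian o))
include hP

theorem moment_one_of_mem (u : (N.friedrichsLaplacian o).domain) (hu : Memℓp (N.lapE u) 2) :
    P.moment 1 (u : N.EnergySpace)
      = ENNReal.ofReal (‖(⟨N.lapE u, hu⟩ : lp (fun _ : G => ℂ) 2)‖ ^ 2) := by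
  rw [hP.moment_one, inner_friedrichsLaplacian N o hu u hu, @norm_sq_eq_re_inner ℂ]
  rfl

/-- The first moment is the squared `ℓ²` norm of the pointwise Laplacian, also where it is
infinite. -/
theorem moment_one_eq (u : N.EnergySpace) : P.moment 1 u = ∑' x, ‖N.lapE u x‖ₑ ^ 2 := by
  have hdom : ∀ n : ℕ, P.proj (Set.Iic (n : ℝ≥0)) u ∈ (N.friedrichsLaplacian o).domain := fun n =>
    hP.proj_mem_domain_of_subset_Iic measurableSet_Iic subset_rfl u
  have hmem : ∀ n : ℕ, Memℓp (N.lapE (P.proj (Set.Iic (n : ℝ≥0)) u)) 2 := fun n =>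
    ((N.mem_friedrichs_domain_iff o _).1 (hdom n)).1
  refine le_antisymm ?_ ?_
  · by_cases htop : ∑' x, ‖N.lapE u x‖ₑ ^ 2 = ∞
    · rw [htop]; exact le_top
    have hu := memlp_of_tsum_enorm_sq htop
    have hval := tsum_enorm_sq_lp (⟨N.lapE u, hu⟩ : lp (fun _ : G => ℂ) 2)
    refine ProjectionValuedMeasure.moment_le_of_forall_proj_Iic fun n => ?_
    set u' : (N.friedrichsLaplacian o).domain := ⟨_, hdom n⟩ with hu'
    -- `‖Δ P u‖² = ⟪P u, L P u⟫ = ⟪u, L P u⟫ = ⟪Δ u, Δ P u⟫`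
    have h1 : ⟪(u' : N.EnergySpace), N.friedrichsLaplacian o u'⟫_ℂ
        = ⟪u, N.friedrichsLaplacian o u'⟫_ℂ := by
      have h2 := hP.proj_apply_of_proj_eq (B := Set.Iic (n : ℝ≥0)) measurableSet_Iic u'
        (by rw [hu', ProjectionValuedMeasure.proj_proj measurableSet_Iic measurableSet_Iic,
              Set.inter_self])
      refine (ProjectionValuedMeasure.inner_proj_left measurableSet_Iic u _).trans ?_
      rw [h2]
    rw [inner_friedrichsLaplacian N o (hmem n) u' (hmem n),
      inner_friedrichsLaplacian N o hu u' (hmem n)] at h1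
    refine (moment_one_of_mem hP u' (hmem n)).trans_le (le_trans ?_ hval.ge)
    have h3 := norm_inner_le_norm (𝕜 := ℂ) (⟨N.lapE u, hu⟩ : lp (fun _ : G => ℂ) 2)
      ⟨N.lapE u', hmem n⟩
    rw [← h1, inner_self_eq_norm_sq_to_K, norm_pow, RCLike.norm_ofReal, abs_norm, sq] at h3
    refine ENNReal.ofReal_le_ofReal (pow_le_pow_left₀ (norm_nonneg _) ?_ 2)
    rcases (norm_nonneg (⟨N.lapE u', hmem n⟩ : lp (fun _ : G => ℂ) 2)).eq_or_lt with h0 | h0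
    · rw [← h0]; exact norm_nonneg _
    · exact le_of_mul_le_mul_right h3 h0
  · -- lower semicontinuity along the cut-offs `P([0, n]) u → u`
    rw [ENNReal.tsum_eq_iSup_sum]
    refine iSup_le fun s => ?_
    have hlim : Tendsto (fun n : ℕ => ∑ x ∈ s, ‖N.lapE (P.proj (Set.Iic (n : ℝ≥0)) u) x‖ₑ ^ 2) atTop
        (𝓝 (∑ x ∈ s, ‖N.lapE u x‖ₑ ^ 2)) := by
      refine tendsto_finsetSum _ fun x _ => ?_
      exact ((ENNReal.continuous_pow 2).comp
        (continuous_enorm.comp (N.continuous_lapE_apply x))).tendsto u |>.comp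
          (ProjectionValuedMeasure.tendsto_proj_Iic u)
    refine le_of_tendsto' hlim fun n => ?_
    refine (ENNReal.sum_le_tsum s).trans (le_trans ?_
      (ProjectionValuedMeasure.moment_proj_le (B := Set.Iic (n : ℝ≥0)) measurableSet_Iic 1 u))
    exact ((tsum_enorm_sq_lp (⟨N.lapE _, hmem n⟩ : lp (fun _ : G => ℂ) 2)).trans
      (moment_one_of_mem hP ⟨_, hdom n⟩ (hmem n)).symm).le

theorem moment_two_eq_top {u : N.EnergySpace} (hu : u ∉ (N.friedrichsLaplacian o).domain) :
    P.moment 2 u = ∞ := by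
  rw [hP.mem_domain_iff, not_lt, top_le_iff] at hu
  exact hu

omit hP

/-! ### Comparison of two networks -/

variable {b c : Network G}

/-- `Δ_c (I* u) = Δ_b u` pointwise, because `Δ u (x) = ⟪δ_x, u⟫` and `I δ_x = δ_x`. -/
theorem lapE_adjoint_inclusion (hbc : ∀ x y, b.cond x y ≤ c.cond x y) (u : b.EnergySpace) :
    c.lapE (ContinuousLinearMap.adjoint (inclusion hbc) u) = b.lapE u := by
  funext x
  rw [← inner_dirac, ← inner_dirac, ContinuousLinearMap.adjoint_inner_right, inclusion_mk]
  rfl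

theorem norm_inclusion_le (hbc : ∀ x y, b.cond x y ≤ c.cond x y) (u : c.EnergySpace) :
    ‖inclusion hbc u‖ ≤ ‖u‖ := by
  have h : ‖inclusion hbc‖ ≤ 1 := LinearMap.mkContinuous_norm_le _ zero_le_one _
  simpa using (inclusion hbc).le_of_opNorm_le h u

/-- The second moment is the energy of `Δ u` where that is finite, and the energy grows with the
conductances. -/
theorem moment_two_le_of_lapE_eq (hbc : ∀ x y, b.cond x y ≤ c.cond x y)
    {Pb : ProjectionValuedMeasure b.EnergySpace}
    {Pc : ProjectionValuedMeasure c.EnergySpace}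
    (hb : Pb.IsSpectralResolution (b.friedrichsLaplacian o))
    (hc : Pc.IsSpectralResolution (c.friedrichsLaplacian o)) {u : b.EnergySpace}
    {v : c.EnergySpace} (huv : c.lapE v = b.lapE u) : Pb.moment 2 u ≤ Pc.moment 2 v := by
  by_cases hv : v ∈ (c.friedrichsLaplacian o).domain
  · obtain ⟨hv1, hv2⟩ := (c.mem_friedrichs_domain_iff o v).1 hv
    have hfin : b.lapE u ∈ b.energyDomain := FiniteEnergy.mono hbc (huv ▸ hv2)
    have hu : u ∈ (b.friedrichsLaplacian o).domain :=
      (b.mem_friedrichs_domain_iff o u).2 ⟨huv ▸ hv1, hfin⟩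
    have hI : inclusion hbc (c.friedrichsLaplacian o ⟨v, hv⟩)
        = b.friedrichsLaplacian o ⟨u, hu⟩ := by
      rw [friedrichsLaplacian_apply c o ⟨v, hv⟩ hv2, friedrichsLaplacian_apply b o ⟨u, hu⟩ hfin,
        inclusion_mk]
      exact congrArg b.toEnergy (Subtype.ext huv)
    have h1 := hb.moment_two ⟨u, hu⟩
    have h2 := hc.moment_two ⟨v, hv⟩
    rw [← hI] at h1
    rw [h1, h2]
    exact ENNReal.ofReal_le_ofReal (pow_le_pow_left₀ (norm_nonneg _) (norm_inclusion_le hbc _) 2)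
  · rw [moment_two_eq_top hc hv]
    exact le_top

end Network

end NetworkLaplacian

theorem mainTheorem3 {G : Type*} (b c : Network G) (hbc : ∀ x y, b.cond x y ≤ c.cond x y)
    (o : G) :
    (∃ P : ProjectionValuedMeasure b.EnergySpace,
      P.IsSpectralResolution (b.friedrichsLaplacian o)) ∧
    (∃ P : ProjectionValuedMeasure c.EnergySpace,
      P.IsSpectralResolution (c.friedrichsLaplacian o)) ∧
    ∀ (Pb : ProjectionValuedMeasure b.EnergySpace) (Pc : ProjectionValuedMeasure c.EnergySpace),
      Pb.IsSpectralResolution (b.friedrichsLaplacian o) →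
      Pc.IsSpectralResolution (c.friedrichsLaplacian o) →
      ∀ u : b.EnergySpace,
        Pb.moment 1 u = Pc.moment 1 (ContinuousLinearMap.adjoint (Network.inclusion hbc) u) ∧
        Pb.moment 2 u ≤ Pc.moment 2 (ContinuousLinearMap.adjoint (Network.inclusion hbc) u) := by
  refine ⟨b.exists_isSpectralResolution o, c.exists_isSpectralResolution o,
    fun Pb Pc hb hc u => ⟨?_,
      Network.moment_two_le_of_lapE_eq hbc hb hc (Network.lapE_adjoint_inclusion hbc u)⟩⟩
  rw [Network.moment_one_eq hb, Network.moment_one_eq hc, Network.lapE_adjoint_inclusion]
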